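/- Let $p$ be a prime and let $(R,\mathfrak m_R)$, $(S,\mathfrak m_S)$, $(T,\mathfrak m_T)$ be commutative Noetherian local rings of characteristic $p$. Let $\epsilon_R\colon R\to T$ and $\epsilon_S\colon S\to T$ be surjective ring homomorphisms (so that the three rings share the same residue field), and let $$P=R\times_T S=\{(r,x)\in R\times S \mid \epsilon_R(r)=\epsilon_S(x)\},$$ which is again a local ring. For a local ring $(A,\mathfrak m)$ of characteristic $p$ and dimension $d$ and a real number $s>0$, put $$h_s(A)=\lim_{e\to\infty}\frac{\ell_A\big(A/(\mathfrak m^{\lceil sp^e\rceil}+\mathfrak m^{[p^e]})\big)}{p^{ed}},\qquad e_s(A)=\frac{h_s(A)}{\mathcal H_s(d)},\qquad \mathcal H_s(d)=\sum_{i=0}^{\lfloor s\rfloor}\frac{(-1)^i}{d!}\binom di(s-i)^d,$$ where $\ell_A$ denotes length and $\mathfrak m^{[p^e]}$ is the ideal generated by the $p^e$-th powers of the elements of $\mathfrak m$. Then for every real $s>0$ the limits defining $h_s(P)$, $h_s(R)$, $h_s(S)$ and $h_s(T)$ exist, and the following hold. 1. If $\dim R=\dim S=\dim T$, then $h_s(P)=h_s(R)+h_s(S)-h_s(T)$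 and $e_s(P)=e_s(R)+e_s(S)-e_s(T)$. 2. If $\dim R=\dim S>\dim T$, then $h_s(P)=h_s(R)+h_s(S)$ and $e_s(P)=e_s(R)+e_s(S)$. 3. If $\dim R>\dim S>\dim T$, then $h_s(P)=h_s(R)$ and $e_s(P)=e_s(R)$. -/

import Mathlib

open Filter Topology

noncomputable section

/-- The fibre product `R ×_T S = {(r, x) ∈ R × S | εR r = εS x}` (`RingHom.pullback εR εS`) of two
homomorphisms of local rings, of which `εS` is surjective, is a local ring. -/
theorem isLocalRing_fiberProduct {R S T : Type*} [CommRing R] [CommRing S] [CommRing T]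
    [IsLocalRing R] [IsLocalRing S] [IsLocalRing T] (εR : R →+* T) (εS : S →+* T)
    (hεS : Function.Surjective εS) : IsLocalRing (RingHom.pullback εR εS) :=
  have : IsLocalHom εS := .of_surjective εS hεS
  RingHom.isLocalRing_pullback εR εS

/-- The bracket power `J^{[q]}`: the ideal generated by the `q`-th powers of the elements of `J`. -/
def bracketPower {R : Type*} [CommRing R] (J : Ideal R) (q : ℕ) : Ideal R :=
  Ideal.span ((fun x : R => x ^ q) '' (J : Set R))

/-- The Krull dimension as a natural number (for rings of finite Krull dimension, such as
Noetherian local rings). -/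
def krullDimNat (R : Type*) [CommRing R] : ℕ :=
  ((ringKrullDim R).unbotD 0).toNat

/-- The `e`-th term `ℓ_R (M / (I^⌈s p^e⌉ + J^{[p^e]}) M) / p^{e d}`, `d = dim R`, of the sequence
whose limit is the `h`-function. -/
def hTerm {R : Type*} [CommRing R] (p : ℕ) (I J : Ideal R) (M : Type*) [AddCommGroup M]
    [Module R M] (s : ℝ) (e : ℕ) : ℝ :=
  ((Module.length R
      (M ⧸ ((I ^ ⌈s * (p : ℝ) ^ e⌉₊ ⊔ bracketPower J (p ^ e)) • (⊤ : Submodule R M)))).toNat : ℝ)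
    / (p : ℝ) ^ (e * krullDimNat R)

/-- The `h`-function `h_s(I, J; M)`. -/
def hFunction {R : Type*} [CommRing R] (p : ℕ) (I J : Ideal R) (M : Type*) [AddCommGroup M]
    [Module R M] (s : ℝ) : ℝ :=
  limUnder atTop (hTerm p I J M s)

/-- The normalizing factor `H_s(d) = ∑_{i = 0}^{⌊s⌋} ((-1)^i / d!) (d choose i) (s - i)^d`. -/
def hNormalizer (s : ℝ) (d : ℕ) : ℝ :=
  ∑ i ∈ Finset.range (⌊s⌋₊ + 1),
    (-1 : ℝ) ^ i / (d.factorial : ℝ) * (d.choose i : ℝ) * (s - (i : ℝ)) ^ d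

/-- The `s`-multiplicity `e_s(I, J; M) = h_s(I, J; M) / H_s(dim R)`. -/
def sMultiplicity {R : Type*} [CommRing R] (p : ℕ) (I J : Ideal R) (M : Type*) [AddCommGroup M]
    [Module R M] (s : ℝ) : ℝ :=
  hFunction p I J M s / hNormalizer s (krullDimNat R)

/-- The limit defining `h_s(R) = h_s(𝔪, 𝔪; R)` exists (in `ℝ`). -/
def HasHLimit (p : ℕ) (R : Type*) [CommRing R] [IsLocalRing R] (s : ℝ) : Prop :=
  ∃ l : ℝ, Tendsto
    (hTerm p (IsLocalRing.maximalIdeal R) (IsLocalRing.maximalIdeal R) R s) atTop (𝓝 l)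

/-- `h_s(R) = h_s(𝔪, 𝔪; R)` for a local ring `(R, 𝔪)`. -/
def hLocal (p : ℕ) (R : Type*) [CommRing R] [IsLocalRing R] (s : ℝ) : ℝ :=
  hFunction p (IsLocalRing.maximalIdeal R) (IsLocalRing.maximalIdeal R) R s

/-- `e_s(R) = e_s(𝔪, 𝔪; R)` for a local ring `(R, 𝔪)`. -/
def eLocal (p : ℕ) (R : Type*) [CommRing R] [IsLocalRing R] (s : ℝ) : ℝ :=
  sMultiplicity p (IsLocalRing.maximalIdeal R) (IsLocalRing.maximalIdeal R) R s

end

section HFunction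

open IsLocalRing Asymptotics

section Length

variable {A : Type*} [CommRing A]

theorem Module.length_le_add_of_exact {N M L : Type*} [AddCommGroup N] [AddCommGroup M]
    [AddCommGroup L] [Module A N] [Module A M] [Module A L] (f : N →ₗ[A] M) (g : M →ₗ[A] L)
    (h : Function.Exact f g) :
    Module.length A M ≤ Module.length A N + Module.length A L := by
  rw [Module.length_eq_add_of_exact (LinearMap.ker g).subtype (LinearMap.rangeRestrict g)
    (Submodule.subtype_injective _) (LinearMap.surjective_rangeRestrict g)
    (by rw [LinearMap.exact_iff, LinearMap.ker_rangeRestrict, Submodule.range_subtype])]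
  gcongr
  · rw [LinearMap.exact_iff.mp h]
    exact Module.length_le_of_surjective _ (LinearMap.surjective_rangeRestrict f)
  · exact Module.length_le_of_injective _ (Submodule.subtype_injective _)

variable {M N L : Type*} [AddCommGroup M] [Module A M] [AddCommGroup N] [Module A N]
  [AddCommGroup L] [Module A L]

/-- The map on quotients by `I • ⊤` induced by a linear map. -/
def LinearMap.quotSMulTop (I : Ideal A) (f : M →ₗ[A] N) :
    (M ⧸ (I • (⊤ : Submodule A M))) →ₗ[A] (N ⧸ (I • (⊤ : Submodule A N))) :=
  Submodule.mapQ _ _ f (Submodule.map_le_iff_le_comap.mp (by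
    rw [Submodule.map_smul'']; exact Submodule.smul_mono le_rfl le_top))

@[simp]
theorem LinearMap.quotSMulTop_mk (I : Ideal A) (f : M →ₗ[A] N) (x : M) :
    f.quotSMulTop I (Submodule.Quotient.mk x) = Submodule.Quotient.mk (f x) := rfl

theorem LinearMap.quotSMulTop_surjective (I : Ideal A) {f : M →ₗ[A] N}
    (hf : Function.Surjective f) : Function.Surjective (f.quotSMulTop I) := by
  intro y
  obtain ⟨y, rfl⟩ := Submodule.Quotient.mk_surjective _ y
  obtain ⟨x, rfl⟩ := hf y
  exact ⟨Submodule.Quotient.mk x, rfl⟩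

theorem LinearMap.quotSMulTop_exact (I : Ideal A) {f : N →ₗ[A] M} {g : M →ₗ[A] L}
    (h : Function.Exact f g) (hg : Function.Surjective g) :
    Function.Exact (f.quotSMulTop I) (g.quotSMulTop I) := by
  intro y
  obtain ⟨y, rfl⟩ := Submodule.Quotient.mk_surjective _ y
  constructor
  · intro hy
    rw [quotSMulTop_mk, Submodule.Quotient.mk_eq_zero] at hy
    have h1 : (I • (⊤ : Submodule A L)) = (I • (⊤ : Submodule A M)).map g := by
      rw [Submodule.map_smul'', Submodule.map_top, LinearMap.range_eq_top.mpr hg]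
    rw [h1] at hy
    obtain ⟨z, hz, hzy⟩ := hy
    obtain ⟨x, hx⟩ := (h (y - z)).mp (by rw [map_sub, hzy, sub_self])
    refine ⟨Submodule.Quotient.mk x, ?_⟩
    rw [quotSMulTop_mk, hx, Submodule.Quotient.eq]
    simpa using hz
  · rintro ⟨x, hx⟩
    obtain ⟨x, rfl⟩ := Submodule.Quotient.mk_surjective _ x
    rw [← hx, quotSMulTop_mk, quotSMulTop_mk, h.apply_apply_eq_zero]
    rfl

/-- The length of `M / I M`. -/
noncomputable def colength (I : Ideal A) (M : Type*) [AddCommGroup M] [Module A M] : ℕ∞ :=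
  Module.length A (M ⧸ (I • (⊤ : Submodule A M)))

theorem colength_le_of_surjective (I : Ideal A) {f : M →ₗ[A] N} (hf : Function.Surjective f) :
    colength I N ≤ colength I M :=
  Module.length_le_of_surjective _ (LinearMap.quotSMulTop_surjective I hf)

theorem colength_congr (I : Ideal A) (e : M ≃ₗ[A] N) : colength I M = colength I N :=
  le_antisymm (colength_le_of_surjective I e.symm.surjective)
    (colength_le_of_surjective I e.surjective)

theorem colength_le_add (I : Ideal A) {f : N →ₗ[A] M} {g : M →ₗ[A] L}
    (h : Function.Exact f g) (hg : Function.Surjective g) :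
    colength I M ≤ colength I N + colength I L :=
  Module.length_le_add_of_exact _ _ (LinearMap.quotSMulTop_exact I h hg)

theorem colength_prod (I : Ideal A) : colength I N + colength I L ≤ colength I (N × L) := by
  unfold colength
  rw [← Module.length_prod]
  refine Module.length_le_of_surjective
    (((LinearMap.fst A N L).quotSMulTop I).prod ((LinearMap.snd A N L).quotSMulTop I)) ?_
  rintro ⟨x, y⟩
  obtain ⟨x, rfl⟩ := Submodule.Quotient.mk_surjective _ x
  obtain ⟨y, rfl⟩ := Submodule.Quotient.mk_surjective _ y
  exact ⟨Submodule.Quotient.mk (x, y), rfl⟩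

theorem colength_anti {I J : Ideal A} (h : I ≤ J) (M : Type*) [AddCommGroup M] [Module A M] :
    colength J M ≤ colength I M :=
  Module.length_le_of_surjective (Submodule.factor (Submodule.smul_mono h le_rfl))
    (Submodule.factor_surjective _)

theorem colength_sup_pow_le (J : Ideal A) (x : A) (q : ℕ) (M : Type*) [AddCommGroup M]
    [Module A M] :
    colength (J ⊔ Ideal.span {x ^ q}) M ≤ q * colength (J ⊔ Ideal.span {x}) M := by
  induction q with
  | zero =>
    have : Subsingleton (M ⧸ ((J ⊔ Ideal.span {x ^ 0}) • (⊤ : Submodule A M))) := by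
      rw [Submodule.Quotient.subsingleton_iff]; simp
    simp [colength]
  | succ q ih =>
    have hle : (J ⊔ Ideal.span {x ^ (q + 1)}) ≤ J ⊔ Ideal.span {x} :=
      sup_le_sup le_rfl (Ideal.span_singleton_le_span_singleton.mpr (dvd_pow_self x (by omega)))
    have hcomap : (J ⊔ Ideal.span {x ^ q}) • (⊤ : Submodule A M) ≤
        ((J ⊔ Ideal.span {x ^ (q + 1)}) • (⊤ : Submodule A M)).comap
          (LinearMap.lsmul A M x) := by
      rw [← Submodule.map_le_iff_le_comap, Submodule.map_le_iff_le_comap,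
        Submodule.smul_le]
      intro r hr n _
      rw [Submodule.mem_comap, LinearMap.lsmul_apply, smul_smul]
      refine Submodule.smul_mem_smul ?_ trivial
      rw [Submodule.mem_sup] at hr ⊢
      obtain ⟨a, ha, b, hb, rfl⟩ := hr
      refine ⟨x * a, J.mul_mem_left _ ha, x * b, ?_, by ring⟩
      rw [Ideal.mem_span_singleton] at hb ⊢
      rw [pow_succ']
      exact mul_dvd_mul_left x hb
    have := Module.length_le_add_of_exact
      (Submodule.mapQ _ ((J ⊔ Ideal.span {x ^ (q + 1)}) • (⊤ : Submodule A M)) _ hcomap)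
      (Submodule.factor (Submodule.smul_mono hle (le_refl (⊤ : Submodule A M)))) ?_
    · refine this.trans ?_
      rw [Nat.cast_succ, add_mul, one_mul]
      exact add_le_add ih le_rfl
    · intro y
      obtain ⟨y, rfl⟩ := Submodule.Quotient.mk_surjective _ y
      constructor
      · intro hy
        change (Submodule.Quotient.mk y : M ⧸ (J ⊔ Ideal.span {x}) • (⊤ : Submodule A M)) = 0 at hy
        rw [Submodule.Quotient.mk_eq_zero, Submodule.sup_smul, Submodule.mem_sup] at hy
        obtain ⟨a, ha, b, hb, rfl⟩ := hy
        rw [Submodule.ideal_span_singleton_smul] at hb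
        obtain ⟨c, -, rfl⟩ := hb
        refine ⟨Submodule.Quotient.mk c, ?_⟩
        rw [Submodule.mapQ_apply, Submodule.Quotient.eq]
        have : (LinearMap.lsmul A M x) c - (a + (DistribSMul.toLinearMap A M x) c) = - a := by
          simp
        rw [this]
        exact neg_mem (Submodule.smul_mono le_sup_left le_rfl ha)
      · rintro ⟨c, hc⟩
        obtain ⟨c, rfl⟩ := Submodule.Quotient.mk_surjective _ c
        rw [← hc]
        change (Submodule.Quotient.mk (x • c) : M ⧸ (J ⊔ Ideal.span {x}) • (⊤ : Submodule A M)) = 0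
        rw [Submodule.Quotient.mk_eq_zero]
        exact Submodule.smul_mem_smul (Ideal.mem_sup_right (Ideal.mem_span_singleton_self x))
          trivial

theorem colength_sup_span_pow_le (J : Ideal A) (s : Finset A) (q : ℕ) (M : Type*)
    [AddCommGroup M] [Module A M] :
    colength (J ⊔ Ideal.span ((fun x => x ^ q) '' (s : Set A))) M ≤
      q ^ s.card * colength (J ⊔ Ideal.span (s : Set A)) M := by
  classical
  induction s using Finset.induction generalizing J with
  | empty => simp
  | insert x s hx ih =>
    rw [Finset.coe_insert, Set.image_insert_eq, Ideal.span_insert, Ideal.span_insert,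
      ← sup_assoc, Finset.card_insert_of_notMem hx, pow_succ, mul_assoc]
    refine (ih _).trans ?_
    gcongr
    rw [sup_right_comm, ← sup_assoc, sup_right_comm J (Ideal.span {x})]
    exact colength_sup_pow_le _ x q M

/-- Elements killed by `x` in `Q` have length at most that of `Q / x Q`. -/
theorem length_submodule_le_of_smul_eq_zero [IsNoetherian A M] [IsArtinian A M]
    (x : A) (E : Submodule A M) (hE : ∀ m ∈ E, x • m = 0) :
    Module.length A E ≤ Module.length A (M ⧸ (Ideal.span {x} • (⊤ : Submodule A M))) := by
  let f := LinearMap.lsmul A M x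
  have h1 := Module.length_eq_add_of_exact (LinearMap.ker f).subtype f.rangeRestrict
    (Submodule.subtype_injective _) (LinearMap.surjective_rangeRestrict f)
    (by rw [LinearMap.exact_iff, LinearMap.ker_rangeRestrict, Submodule.range_subtype])
  have h2 := Module.length_eq_add_of_exact (LinearMap.range f).subtype (LinearMap.range f).mkQ
    (Submodule.subtype_injective _) (Submodule.mkQ_surjective _)
    (LinearMap.exact_subtype_mkQ _)
  have h3 : (Ideal.span {x} • (⊤ : Submodule A M)) = LinearMap.range f := by
    rw [Submodule.ideal_span_singleton_smul]
    ext y; simp [f, Submodule.mem_smul_pointwise_iff_exists]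
  rw [h3]
  have hle : E ≤ LinearMap.ker f := fun m hm => by simpa [f] using hE m hm
  refine (Module.length_le_of_injective (Submodule.inclusion hle)
    (Submodule.inclusion_injective _)).trans ?_
  have hfin : Module.length A (LinearMap.range f) ≠ ⊤ := Module.length_ne_top
  rw [h2, add_comm] at h1
  exact (ENat.add_right_injective_of_ne_top hfin (by simpa [add_comm] using h1)).symm.le

end Length

section BracketPower

variable {A : Type*} [CommRing A]

theorem bracketPower_mono {I J : Ideal A} (h : I ≤ J) (q : ℕ) :
    bracketPower I q ≤ bracketPower J q :=
  Ideal.span_mono (Set.image_mono h)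

theorem pow_mem_bracketPower {I : Ideal A} {x : A} (hx : x ∈ I) (q : ℕ) :
    x ^ q ∈ bracketPower I q :=
  Ideal.subset_span ⟨x, hx, rfl⟩

theorem bracketPower_le_pow (I : Ideal A) (q : ℕ) : bracketPower I q ≤ I ^ q :=
  Ideal.span_le.mpr (by rintro _ ⟨x, hx, rfl⟩; exact Ideal.pow_mem_pow hx q)

theorem bracketPower_eq_map (p : ℕ) [Fact p.Prime] [CharP A p] (I : Ideal A) (n : ℕ) :
    bracketPower I (p ^ n) = I.map (iterateFrobenius A p n) := rfl

theorem bracketPower_map {B : Type*} [CommRing B] (p : ℕ) [Fact p.Prime] [CharP A p] [CharP B p]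
    (f : A →+* B) (I : Ideal A) (n : ℕ) :
    bracketPower (I.map f) (p ^ n) = (bracketPower I (p ^ n)).map f := by
  rw [bracketPower_eq_map, bracketPower_eq_map, Ideal.map_map, Ideal.map_map]
  congr 1
  ext x
  simp [iterateFrobenius_def]

theorem span_pow_le_bracketPower_mul (Q : ℕ) (s : Finset A) (n : ℕ) (hn : Q * s.card + 1 ≤ n) :
    Ideal.span (s : Set A) ^ n ≤
      bracketPower (Ideal.span (s : Set A)) Q * Ideal.span (s : Set A) ^ (n - Q) := by
  classical
  induction s using Finset.induction generalizing n with
  | empty =>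
    have : n ≠ 0 := by omega
    rw [Finset.coe_empty, Ideal.span_empty, ← Ideal.zero_eq_bot, zero_pow this]
    exact bot_le
  | insert x s hx ih =>
    rw [Finset.card_insert_of_notMem hx, mul_add, mul_one] at hn
    set I := Ideal.span ((insert x s : Finset A) : Set A) with hI
    set K := Ideal.span (s : Set A) with hK
    have hKI : K ≤ I := Ideal.span_mono (by simp)
    have hxI : Ideal.span {x} ≤ I := Ideal.span_mono (by simp)
    have hIe : I = Ideal.span {x} + K := by
      rw [hI, Finset.coe_insert, Ideal.span_insert, Submodule.add_eq_sup]
    conv_lhs => rw [hIe]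
    rw [add_pow, Ideal.sum_eq_sup, Finset.sup_le_iff]
    intro i hi
    rw [Finset.mem_range] at hi
    refine Ideal.mul_le_left.trans ?_
    by_cases hiQ : Q ≤ i
    · calc Ideal.span {x} ^ i * K ^ (n - i)
          = Ideal.span {x} ^ Q * (Ideal.span {x} ^ (i - Q) * K ^ (n - i)) := by
            rw [← mul_assoc, ← pow_add, Nat.add_sub_cancel' hiQ]
        _ ≤ bracketPower I Q * (I ^ (i - Q) * I ^ (n - i)) := by
            gcongr
            rw [Ideal.span_singleton_pow, Ideal.span_singleton_le_iff_mem]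
            exact pow_mem_bracketPower (hxI (Ideal.mem_span_singleton_self x)) Q
        _ = _ := by rw [← pow_add]; congr 2; omega
    · calc Ideal.span {x} ^ i * K ^ (n - i)
          ≤ I ^ i * (bracketPower K Q * K ^ (n - i - Q)) := by
            gcongr
            exact ih (n - i) (by omega)
        _ ≤ I ^ i * (bracketPower I Q * I ^ (n - i - Q)) := by
            gcongr
            exact bracketPower_mono hKI Q
        _ = bracketPower I Q * (I ^ i * I ^ (n - i - Q)) := by ring
        _ ≤ _ := by
            rw [← pow_add]
            exact Ideal.mul_mono_right (Ideal.pow_le_pow_right (by omega))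

theorem exists_pow_le_bracketPower_pow [IsNoetherianRing A] (I : Ideal A) (Q : ℕ) :
    ∃ c, ∀ t, I ^ (Q * t + c) ≤ bracketPower I Q ^ t := by
  obtain ⟨s, hs⟩ := IsNoetherian.noetherian I
  change Ideal.span (s : Set A) = I at hs
  refine ⟨Q * s.card + 1, fun t => ?_⟩
  suffices h : I ^ (Q * t + (Q * s.card + 1)) ≤ bracketPower I Q ^ t * I ^ (Q * s.card + 1) from
    h.trans Ideal.mul_le_left
  induction t with
  | zero => simp
  | succ t ih =>
    have := span_pow_le_bracketPower_mul Q s (Q * (t + 1) + (Q * s.card + 1)) (by omega)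
    rw [hs] at this
    refine this.trans ?_
    rw [show Q * (t + 1) + (Q * s.card + 1) - Q = Q * t + (Q * s.card + 1) by
      rw [mul_add]; omega, pow_succ', mul_assoc]
    gcongr

end BracketPower

section Colength

variable {A : Type*} [CommRing A] [IsNoetherianRing A] [IsLocalRing A]

theorem isArtinianRing_quotient_of_pow_le {I : Ideal A} {N : ℕ} (h : maximalIdeal A ^ N ≤ I) :
    IsArtinianRing (A ⧸ I) := by
  by_cases hI : I = ⊤
  · subst hI
    infer_instance
  have : Nontrivial (A ⧸ I) := Ideal.Quotient.nontrivial_iff.mpr hI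
  have : IsLocalRing (A ⧸ I) := .of_surjective' (Ideal.Quotient.mk I) Ideal.Quotient.mk_surjective
  rw [isArtinianRing_iff_isNilpotent_maximalIdeal]
  refine ⟨N, ?_⟩
  rw [← IsLocalRing.map_maximalIdeal_of_surjective (Ideal.Quotient.mk I)
    Ideal.Quotient.mk_surjective, ← Ideal.map_pow, Ideal.zero_eq_bot, Ideal.map_eq_bot_iff_le_ker,
    Ideal.mk_ker]
  exact h

variable (M : Type*) [AddCommGroup M] [Module A M] [Module.Finite A M]

theorem isArtinian_quotient_smul_of_pow_le {I : Ideal A} {N : ℕ} (h : maximalIdeal A ^ N ≤ I) :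
    IsArtinian A (M ⧸ (I • (⊤ : Submodule A M))) := by
  have := isArtinianRing_quotient_of_pow_le h
  have : Module.Finite (A ⧸ I) (M ⧸ (I • (⊤ : Submodule A M))) :=
    Module.Finite.of_restrictScalars_finite A _ _
  have : IsArtinian (A ⧸ I) (M ⧸ (I • (⊤ : Submodule A M))) := inferInstance
  exact isArtinian_of_surjective_algebraMap (R := A ⧸ I) Ideal.Quotient.mk_surjective

theorem colength_ne_top {I : Ideal A} {N : ℕ} (h : maximalIdeal A ^ N ≤ I) :
    colength I M ≠ ⊤ := by
  have := isArtinian_quotient_smul_of_pow_le M h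
  exact Module.length_ne_top

theorem colength_le_add_of_mul_le {I I' : Ideal A} {N : ℕ} (hN : maximalIdeal A ^ N ≤ I)
    (hI : I ≤ I') (z : A) (hz : Ideal.span {z} * I' ≤ I) :
    colength I M ≤ colength I' M + colength (I ⊔ Ideal.span {z}) M := by
  have := isArtinian_quotient_smul_of_pow_le M hN
  have hle : I • (⊤ : Submodule A M) ≤ I' • (⊤ : Submodule A M) := Submodule.smul_mono hI le_rfl
  let Q := M ⧸ (I • (⊤ : Submodule A M))
  let g : Q →ₗ[A] M ⧸ (I' • (⊤ : Submodule A M)) := Submodule.factor hle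
  have h1 := Module.length_eq_add_of_exact (LinearMap.ker g).subtype g
    (Submodule.subtype_injective _) (Submodule.factor_surjective _)
    (by rw [LinearMap.exact_iff, Submodule.range_subtype])
  have hker : LinearMap.ker g = (I' • (⊤ : Submodule A M)).map (Submodule.mkQ _) := by
    simp only [g, Submodule.factor]
    rw [Submodule.ker_mapQ]; rfl
  have h2 := length_submodule_le_of_smul_eq_zero z (LinearMap.ker g) (by
    rw [hker]
    rintro _ ⟨x, hx, rfl⟩
    rw [← map_smul, Submodule.mkQ_apply, Submodule.Quotient.mk_eq_zero]
    have : z • x ∈ (Ideal.span {z} * I') • (⊤ : Submodule A M) := by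
      rw [mul_smul]
      exact Submodule.smul_mem_smul (Ideal.mem_span_singleton_self z) hx
    exact Submodule.smul_mono hz le_rfl this)
  have h3 : Module.length A (Q ⧸ (Ideal.span {z} • (⊤ : Submodule A Q))) ≤
      colength (I ⊔ Ideal.span {z}) M := by
    have hk : (I ⊔ Ideal.span {z}) • (⊤ : Submodule A M) ≤
        LinearMap.ker ((Ideal.span {z} • (⊤ : Submodule A Q)).mkQ.comp
          (Submodule.mkQ (I • (⊤ : Submodule A M)))) := by
      rw [LinearMap.ker_comp, Submodule.ker_mkQ, ← Submodule.map_le_iff_le_comap,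
        Submodule.map_smul'', Submodule.map_top, Submodule.range_mkQ, Submodule.sup_smul]
      refine sup_le ?_ le_rfl
      rw [Submodule.smul_le]
      intro r hr q _
      obtain ⟨q, rfl⟩ := Submodule.Quotient.mk_surjective _ q
      rw [← Submodule.Quotient.mk_smul, (Submodule.Quotient.mk_eq_zero _).mpr
        (Submodule.smul_mem_smul hr Submodule.mem_top)]
      exact zero_mem _
    refine Module.length_le_of_surjective (Submodule.liftQ _ _ hk) ?_
    rw [← LinearMap.range_eq_top, Submodule.range_liftQ, LinearMap.range_eq_top]
    exact (Submodule.mkQ_surjective _).comp (Submodule.mkQ_surjective _)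
  unfold colength at *
  rw [h1, add_comm]
  gcongr
  exact h2.trans h3

end Colength

section HLength

variable (p : ℕ) {A : Type*} [CommRing A] [IsLocalRing A]

variable (A) in
/-- The ideal `𝔪^⌈s p^e⌉ + 𝔪^{[p^e]}`. -/
noncomputable def hIdeal (s : ℝ) (e : ℕ) : Ideal A :=
  maximalIdeal A ^ ⌈s * (p : ℝ) ^ e⌉₊ ⊔ bracketPower (maximalIdeal A) (p ^ e)

variable (A) in
/-- The length of `M / (𝔪^⌈s p^e⌉ + 𝔪^{[p^e]}) M` as a real number. -/
noncomputable def hLength (s : ℝ) (M : Type*) [AddCommGroup M] [Module A M] (e : ℕ) : ℝ :=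
  ((colength (hIdeal p A s e) M).toNat : ℝ)

theorem maximalIdeal_pow_le_hIdeal (s : ℝ) (e : ℕ) :
    maximalIdeal A ^ ⌈s * (p : ℝ) ^ e⌉₊ ≤ hIdeal p A s e := le_sup_left

variable {M N L : Type*} [AddCommGroup M] [Module A M] [AddCommGroup N] [Module A N]
  [AddCommGroup L] [Module A L]

theorem hLength_nonneg (s : ℝ) (M : Type*) [AddCommGroup M] [Module A M] (e : ℕ) :
    0 ≤ hLength p A s M e := Nat.cast_nonneg _

theorem hLength_congr (s : ℝ) (f : M ≃ₗ[A] N) : hLength p A s M = hLength p A s N := by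
  ext e; unfold hLength; rw [colength_congr _ f]

variable [IsNoetherianRing A]

variable (A) in
theorem colength_hIdeal_ne_top (s : ℝ) (e : ℕ) (M : Type*) [AddCommGroup M] [Module A M]
    [Module.Finite A M] : colength (hIdeal p A s e) M ≠ ⊤ :=
  colength_ne_top M (maximalIdeal_pow_le_hIdeal p s e)

variable [Module.Finite A N] [Module.Finite A L]

theorem hLength_le_add (s : ℝ) (e : ℕ) {f : N →ₗ[A] M} {g : M →ₗ[A] L}
    (h : Function.Exact f g) (hg : Function.Surjective g) :
    hLength p A s M e ≤ hLength p A s N e + hLength p A s L e := by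
  unfold hLength
  have hN := colength_hIdeal_ne_top p A s e N
  have hL := colength_hIdeal_ne_top p A s e L
  rw [← Nat.cast_add, ← ENat.toNat_add hN hL]
  exact_mod_cast ENat.toNat_le_toNat (colength_le_add _ h hg) (by simp [hN, hL])

theorem hLength_prod (s : ℝ) (e : ℕ) :
    hLength p A s N e + hLength p A s L e ≤ hLength p A s (N × L) e := by
  unfold hLength
  have hN := colength_hIdeal_ne_top p A s e N
  have hL := colength_hIdeal_ne_top p A s e L
  rw [← Nat.cast_add, ← ENat.toNat_add hN hL]
  exact_mod_cast ENat.toNat_le_toNat (colength_prod _) (colength_hIdeal_ne_top p A s e _)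

omit [Module.Finite A L] in
theorem hLength_le_add_cokernel [Module.Finite A M] (s : ℝ) (e : ℕ) (f : N →ₗ[A] M) :
    hLength p A s M e ≤ hLength p A s N e + hLength p A s (M ⧸ LinearMap.range f) e :=
  hLength_le_add p s e (f := f) (g := (LinearMap.range f).mkQ) (LinearMap.exact_map_mkQ_range f)
    (Submodule.mkQ_surjective _)

end HLength

section Parameters

variable (A : Type*) [CommRing A] [IsNoetherianRing A] [IsLocalRing A]

theorem exists_finset_parameters :
    ∃ s : Finset A, (s : Set A) ⊆ maximalIdeal A ∧ (s.card : WithBot ℕ∞) = ringKrullDim A ∧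
      ∃ N, maximalIdeal A ^ N ≤ Ideal.span (s : Set A) := by
  obtain ⟨s, hs, hc⟩ :=
    Ideal.exists_finset_card_eq_height_of_isNoetherianRing (maximalIdeal A)
  refine ⟨s, Ideal.span_le.mp hs.1.2, ?_, ?_⟩
  · rw [← IsLocalRing.maximalIdeal_height_eq_ringKrullDim, ← hc]; rfl
  · apply Ideal.exists_pow_le_of_le_radical_of_fg _ (IsNoetherian.noetherian _)
    rw [Ideal.radical_eq_sInf]
    refine le_sInf fun P hP => ?_
    have := hP.2
    exact hs.2 ⟨hP.2, hP.1⟩ (IsLocalRing.le_maximalIdeal hP.2.ne_top)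

variable {A}

theorem exists_finset_parameters_of_ringKrullDim_quotient_le {K : Ideal A}
    (hK : K ≤ maximalIdeal A) {n : ℕ} (hn : ringKrullDim (A ⧸ K) ≤ n) :
    ∃ s : Finset A, (s : Set A) ⊆ maximalIdeal A ∧ s.card ≤ n ∧
      ∃ N, maximalIdeal A ^ N ≤ K ⊔ Ideal.span (s : Set A) := by
  classical
  have : Nontrivial (A ⧸ K) := Ideal.Quotient.nontrivial_iff.mpr
    (fun h => (maximalIdeal.isMaximal A).ne_top (top_le_iff.mp (h ▸ hK)))
  have : IsLocalRing (A ⧸ K) := .of_surjective' (Ideal.Quotient.mk K) Ideal.Quotient.mk_surjective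
  obtain ⟨s, hs, hc, N, hN⟩ := exists_finset_parameters (A ⧸ K)
  have hmax := IsLocalRing.map_maximalIdeal_of_surjective (Ideal.Quotient.mk K)
    Ideal.Quotient.mk_surjective
  let g := Function.surjInv (Ideal.Quotient.mk_surjective (I := K))
  have hg : ∀ x, Ideal.Quotient.mk K (g x) = x := Function.surjInv_eq _
  refine ⟨s.image g, ?_, ?_, N, ?_⟩
  · intro x hx
    rw [Finset.coe_image] at hx
    obtain ⟨y, hy, rfl⟩ := hx
    have : Ideal.Quotient.mk K (g y) ∈ maximalIdeal (A ⧸ K) := by rw [hg]; exact hs hy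
    rw [← hmax, Ideal.mem_map_iff_of_surjective _ Ideal.Quotient.mk_surjective] at this
    obtain ⟨z, hz, hzy⟩ := this
    have h1 := hK (Ideal.Quotient.eq.mp hzy)
    have h2 := sub_mem hz h1
    rwa [sub_sub_cancel] at h2
  · refine Finset.card_image_le.trans ?_
    rw [← hc] at hn
    exact_mod_cast hn
  · rw [← hmax, ← Ideal.map_pow] at hN
    have hspan : Ideal.span (s : Set (A ⧸ K)) =
        (Ideal.span ((s.image g : Finset A) : Set A)).map (Ideal.Quotient.mk K) := by
      rw [Ideal.map_span, Finset.coe_image, Set.image_image]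
      simp [hg]
    rw [hspan, Ideal.map_le_iff_le_comap,
      Ideal.comap_map_of_surjective _ Ideal.Quotient.mk_surjective, ← RingHom.ker_eq_comap_bot,
      Ideal.mk_ker, sup_comm] at hN
    exact hN

theorem exists_parameter_pow {n : ℕ} (hn : ringKrullDim A ≤ (n + 1 : ℕ)) :
    ∃ y ∈ maximalIdeal A, ∃ s : Finset A, (s : Set A) ⊆ maximalIdeal A ∧ s.card ≤ n ∧
      ∀ c, ∃ N, maximalIdeal A ^ N ≤ Ideal.span {y ^ c} ⊔ Ideal.span (s : Set A) := by
  classical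
  obtain ⟨s, hs, hc, N, hN⟩ := exists_finset_parameters A
  rw [← hc] at hn
  have hn : s.card ≤ n + 1 := by exact_mod_cast hn
  have key : ∃ y ∈ maximalIdeal A, ∃ t : Finset A, (t : Set A) ⊆ maximalIdeal A ∧ t.card ≤ n ∧
      maximalIdeal A ^ N ≤ Ideal.span {y} ⊔ Ideal.span (t : Set A) := by
    rcases s.eq_empty_or_nonempty with rfl | ⟨y, hy⟩
    · exact ⟨0, zero_mem _, ∅, by simp, by simp, hN.trans le_sup_right⟩
    · refine ⟨y, hs hy, s.erase y, (Finset.coe_subset.mpr (s.erase_subset y)).trans hs, ?_, ?_⟩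
      · rw [Finset.card_erase_of_mem hy]; omega
      · rw [← Ideal.span_insert, ← Finset.coe_insert, Finset.insert_erase hy]
        exact hN
  obtain ⟨y, hy, t, ht, htc, hle⟩ := key
  refine ⟨y, hy, t, ht, htc, fun c => ?_⟩
  apply Ideal.exists_pow_le_of_le_radical_of_fg _ (IsNoetherian.noetherian _)
  have h1 : maximalIdeal A ≤ (Ideal.span {y} ⊔ Ideal.span (t : Set A)).radical :=
    fun x hx => ⟨N, hle (Ideal.pow_mem_pow hx N)⟩
  refine h1.trans (Ideal.radical_le_radical_iff.mpr (sup_le ?_ ?_))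
  · rw [Ideal.span_singleton_le_iff_mem]
    exact ⟨c, Ideal.mem_sup_left (Ideal.mem_span_singleton_self _)⟩
  · exact le_sup_right.trans Ideal.le_radical

omit [IsNoetherianRing A] [IsLocalRing A] in
open scoped Pointwise in
theorem ringKrullDim_quotient_span_singleton_le {n : ℕ} (hn : ringKrullDim A ≤ (n + 1 : ℕ))
    {y : A} (hy : ∀ P ∈ minimalPrimes A, y ∉ P) :
    ringKrullDim (A ⧸ Ideal.span {y}) ≤ n := by
  have hann : Module.annihilator A A = ⊥ := by
    rw [Module.annihilator_eq_bot]; infer_instance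
  have h := Module.supportDim_quotSMulTop_succ_le_of_notMem_minimalPrimes (M := A) (x := y)
    (by rw [hann]; exact hy)
  rw [Module.supportDim_self_eq_ringKrullDim] at h
  have hs : Ideal.span {y} = (y • (⊤ : Submodule A A) : Submodule A A) := by
    rw [← Submodule.ideal_span_singleton_smul]; simp
  have h2 : ringKrullDim (A ⧸ Ideal.span {y}) = Module.supportDim A (QuotSMulTop y A) := by
    rw [← Module.supportDim_quotient_eq_ringKrullDim, hs]
  rw [h2]
  have h3 := ENat.WithBot.add_one_le_natCast_iff.mp (h.trans hn)
  rw [Nat.cast_succ] at h3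
  exact ENat.WithBot.lt_add_one_iff.mp h3

end Parameters

section Negligible

variable (p : ℕ) [hp : Fact p.Prime] {A : Type*} [CommRing A] [IsLocalRing A] [IsNoetherianRing A]
variable (s : ℝ) (M : Type*) [AddCommGroup M] [Module A M] [Module.Finite A M]

omit [IsNoetherianRing A] [Module.Finite A M] in
theorem colength_bracketPower_le (J K : Ideal A) (hK : J • (⊤ : Submodule A M) ≤ K • ⊤)
    {t : Finset A} (ht : (t : Set A) ⊆ maximalIdeal A) (q : ℕ) :
    colength (K ⊔ bracketPower (maximalIdeal A) q) M ≤
      q ^ t.card * colength (J ⊔ Ideal.span (t : Set A)) M := by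
  refine le_trans ?_ (colength_sup_span_pow_le J t q M)
  refine Module.length_le_of_surjective (Submodule.factor ?_) (Submodule.factor_surjective _)
  rw [Submodule.sup_smul, Submodule.sup_smul]
  refine sup_le_sup hK (Submodule.smul_mono (Ideal.span_le.mpr ?_) le_rfl)
  rintro _ ⟨x, hx, rfl⟩
  exact pow_mem_bracketPower (ht hx) q

theorem hLength_isBigO {K : Ideal A} (hK : K • (⊤ : Submodule A M) = ⊥) {t : Finset A}
    (ht : (t : Set A) ⊆ maximalIdeal A) {n : ℕ} (hn : t.card ≤ n) {N : ℕ}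
    (hN : maximalIdeal A ^ N ≤ K ⊔ Ideal.span (t : Set A)) :
    hLength p A s M =O[atTop] fun e => (p : ℝ) ^ (e * n) := by
  have hfin := colength_ne_top M hN
  refine IsBigO.of_bound ((colength (K ⊔ Ideal.span (t : Set A)) M).toNat : ℝ)
    (Eventually.of_forall fun e => ?_)
  have h1 : colength (hIdeal p A s e) M ≤
      ((p ^ e) ^ n : ℕ) * colength (K ⊔ Ideal.span (t : Set A)) M := by
    refine (colength_anti (I := ⊥ ⊔ bracketPower (maximalIdeal A) (p ^ e))
      (by rw [bot_sup_eq]; exact le_sup_right) M).trans ?_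
    refine (colength_bracketPower_le M K ⊥ (by rw [hK]; exact bot_le) ht (p ^ e)).trans ?_
    push_cast
    gcongr
    exact_mod_cast Nat.one_le_pow _ _ hp.out.pos
  have h2 := ENat.toNat_le_toNat h1 (WithTop.mul_ne_top (ENat.natCast_ne_top _) hfin)
  rw [ENat.toNat_mul, ENat.toNat_natCast] at h2
  rw [Real.norm_of_nonneg (hLength_nonneg _ _ _ _), Real.norm_of_nonneg (by positivity), mul_comm]
  unfold hLength
  rw [pow_mul]
  exact_mod_cast h2

theorem hLength_isBigO_of_smul_eq_zero {n : ℕ} (hn : ringKrullDim A ≤ (n + 1 : ℕ)) {y : A}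
    (hy : ∀ P ∈ minimalPrimes A, y ∉ P) (hM : ∀ m : M, y • m = 0) :
    hLength p A s M =O[atTop] fun e => (p : ℝ) ^ (e * n) := by
  have hK : Ideal.span {y} • (⊤ : Submodule A M) = ⊥ := by
    rw [eq_bot_iff, Submodule.ideal_span_singleton_smul]
    rintro _ ⟨m, -, rfl⟩
    exact hM m
  by_cases hu : IsUnit y
  · have : Ideal.span {y} = ⊤ := Ideal.span_singleton_eq_top.mpr hu
    exact hLength_isBigO p s M hK (t := ∅) (by simp) (Nat.zero_le n) (N := 0) (by simp [this])
  · obtain ⟨t, ht, hc, N, hN⟩ := exists_finset_parameters_of_ringKrullDim_quotient_le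
      ((Ideal.span_singleton_le_iff_mem _).mpr ((mem_maximalIdeal y).mpr hu))
      (ringKrullDim_quotient_span_singleton_le hn hy)
    exact hLength_isBigO p s M hK ht hc hN

theorem exists_colength_pow_add_le {n : ℕ} (hn : ringKrullDim A ≤ (n + 1 : ℕ)) (c : ℕ) :
    ∃ C : ℕ, ∀ q t : ℕ, 0 < q →
      colength (maximalIdeal A ^ (t + c) ⊔ bracketPower (maximalIdeal A) q) M ≤
        colength (maximalIdeal A ^ t ⊔ bracketPower (maximalIdeal A) q) M + (C * q ^ n : ℕ) := by
  obtain ⟨y, hy, u, hu, huc, hN⟩ := exists_parameter_pow hn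
  obtain ⟨N, hN⟩ := hN c
  have hfin := colength_ne_top M hN
  refine ⟨(colength (Ideal.span {y ^ c} ⊔ Ideal.span (u : Set A)) M).toNat, fun q t hq => ?_⟩
  refine (colength_le_add_of_mul_le M (N := t + c) le_sup_left
    (sup_le_sup_right (Ideal.pow_le_pow_right (Nat.le_add_right t c)) _) (y ^ c) ?_).trans ?_
  · rw [Ideal.mul_sup]
    refine sup_le_sup ?_ Ideal.mul_le_right
    rw [add_comm, pow_add]
    exact Ideal.mul_mono_left ((Ideal.span_singleton_le_iff_mem _).mpr (Ideal.pow_mem_pow hy c))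
  · gcongr
    refine (colength_anti (I := Ideal.span {y ^ c} ⊔ bracketPower (maximalIdeal A) q)
      (sup_le le_sup_right (le_sup_right.trans le_sup_left)) M).trans ?_
    refine (colength_bracketPower_le M _ (Ideal.span {y ^ c}) le_rfl hu q).trans ?_
    rw [Nat.cast_mul, ENat.natCast_toNat hfin, mul_comm]
    gcongr
    push_cast
    gcongr
    exact_mod_cast hq

end Negligible

section Pushforward

/-- A `B`-module regarded as an `A`-module along a ring homomorphism `A →+* B`. -/
def Pushforward {A B : Type*} [CommRing A] [CommRing B] (_ : A →+* B) (M : Type*) := M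

variable {A B : Type*} [CommRing A] [CommRing B] (φ : A →+* B) (M N : Type*) [AddCommGroup M]
  [Module B M] [AddCommGroup N] [Module B N]

instance : AddCommGroup (Pushforward φ M) := inferInstanceAs (AddCommGroup M)

instance : Module A (Pushforward φ M) := Module.compHom M φ

namespace Pushforward

variable {M N}

/-- The identity `M → Pushforward φ M` as an additive equivalence. -/
def of : M ≃+ Pushforward φ M := AddEquiv.refl M

theorem smul_of (a : A) (m : M) : a • of φ m = of φ (φ a • m) := rfl

/-- The map on pushforwards induced by a linear map. -/
def map (f : M →ₗ[B] N) : Pushforward φ M →ₗ[A] Pushforward φ N where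
  toFun x := of φ (f ((of φ).symm x))
  map_add' x y := map_add f x y
  map_smul' a x := map_smul f (φ a) ((of φ).symm x)

@[simp]
theorem map_of (f : M →ₗ[B] N) (m : M) : map φ f (of φ m) = of φ (f m) := rfl

variable (M) in
theorem of_mem_smul_top_iff (I : Ideal A) (m : M) :
    of φ m ∈ I • (⊤ : Submodule A (Pushforward φ M)) ↔
      m ∈ I.map φ • (⊤ : Submodule B M) := by
  constructor
  · suffices h : ∀ x ∈ I • (⊤ : Submodule A (Pushforward φ M)),
        (of φ).symm x ∈ I.map φ • (⊤ : Submodule B M) from fun hm => h _ hm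
    intro x hx
    induction hx using Submodule.smul_induction_on' with
    | smul r hr n hn =>
      exact Submodule.smul_mem_smul (Ideal.mem_map_of_mem φ hr)
        (Submodule.mem_top (R := B) (x := (of φ).symm n))
    | add x hx y hy h1 h2 => exact add_mem h1 h2
  · intro hm
    induction hm using Submodule.smul_induction_on' with
    | add x hx y hy h1 h2 => rw [map_add]; exact add_mem h1 h2
    | smul r hr m hm =>
      clear hm
      induction hr using Submodule.span_induction generalizing m with
      | mem x hx =>
        obtain ⟨a, ha, rfl⟩ := hx
        rw [← smul_of]
        exact Submodule.smul_mem_smul ha Submodule.mem_top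
      | zero => rw [zero_smul, map_zero]; exact zero_mem _
      | add x y _ _ h1 h2 => rw [add_smul, map_add]; exact add_mem (h1 m) (h2 m)
      | smul b x _ h =>
        rw [smul_eq_mul, mul_comm, mul_smul]
        exact h _

variable (M) in
/-- Pushforward commutes with the quotients by `I • ⊤`. -/
noncomputable def quotEquiv (I : Ideal A) :
    (Pushforward φ M ⧸ (I • (⊤ : Submodule A (Pushforward φ M)))) ≃ₗ[A]
      Pushforward φ (M ⧸ (I.map φ • (⊤ : Submodule B M))) :=
  (Submodule.quotEquivOfEq _ _ (by
    ext x
    rw [LinearMap.mem_ker]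
    obtain ⟨x, rfl⟩ := (of φ).surjective x
    rw [map_of, of_mem_smul_top_iff, AddEquiv.map_eq_zero_iff, Submodule.mkQ_apply,
      Submodule.Quotient.mk_eq_zero])).trans
  (LinearMap.quotKerEquivOfSurjective (map φ (Submodule.mkQ _))
    (Submodule.mkQ_surjective (I.map φ • (⊤ : Submodule B M))))

theorem length_eq [IsLocalRing A] [IsLocalRing B] [IsLocalHom φ]
    (hφ : Function.Surjective (ResidueField.map φ)) :
    Module.length A (Pushforward φ M) = Module.length B M := by
  let _ := φ.toAlgebra
  let _ : Module A M := Module.compHom M φ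
  have : IsScalarTower A B M := ⟨fun a b m => mul_smul (φ a) b m⟩
  have : IsLocalHom (algebraMap A B) := ‹IsLocalHom φ›
  have h := IsLocalRing.length_restrictScalars A B M
  have h1 : Module.length (ResidueField A) (ResidueField B) = 1 := by
    rw [Module.length_eq_of_surjective (R := ResidueField B) (S := ResidueField A) hφ]
    exact Module.length_eq_one _ _
  rw [h1, mul_one] at h
  exact h

theorem colength_eq [IsLocalRing A] [IsLocalRing B] [IsLocalHom φ]
    (hφ : Function.Surjective (ResidueField.map φ)) (I : Ideal A) :
    colength I (Pushforward φ M) = colength (I.map φ) M := by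
  unfold colength
  rw [(quotEquiv φ M I).length_eq, length_eq φ hφ]

theorem finite (hφ : φ.Finite) [Module.Finite B M] : Module.Finite A (Pushforward φ M) := by
  let _ := φ.toAlgebra
  let _ : Module A M := Module.compHom M φ
  have : IsScalarTower A B M := ⟨fun a b m => mul_smul (φ a) b m⟩
  have : Module.Finite A B := hφ
  exact Module.Finite.trans (R := A) B M

end Pushforward

end Pushforward

section Frobenius

variable (p : ℕ) [hp : Fact p.Prime] {A : Type*} [CommRing A] [IsLocalRing A] [CharP A p]

instance isLocalHom_iterateFrobenius (k : ℕ) : IsLocalHom (iterateFrobenius A p k) where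
  map_nonunit a ha := by
    rw [iterateFrobenius_def] at ha
    exact (isUnit_pow_iff (pow_pos hp.out.pos k).ne').mp ha

instance charP_residueField : CharP (ResidueField A) p :=
  charP_of_injective_ringHom
    ((residue A).comp (ZMod.castHom dvd_rfl A : ZMod p →+* A)).injective p

theorem residueField_map_iterateFrobenius_surjective [PerfectRing (ResidueField A) p] (k : ℕ) :
    Function.Surjective (ResidueField.map (iterateFrobenius A p k)) := by
  intro x
  obtain ⟨y, rfl⟩ := (bijective_iterateFrobenius (ResidueField A) p k).surjective x
  refine ⟨y, ?_⟩
  obtain ⟨y, rfl⟩ := residue_surjective y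
  rw [ResidueField.map_residue, iterateFrobenius_def, iterateFrobenius_def, map_pow]

omit [IsLocalRing A] in
theorem finite_iterateFrobenius (h : (frobenius A p).Finite) (k : ℕ) :
    (iterateFrobenius A p k).Finite := by
  induction k with
  | zero => rw [iterateFrobenius_zero]; exact RingHom.Finite.id A
  | succ k ih =>
    rw [iterateFrobenius_add, iterateFrobenius_one]
    exact RingHom.Finite.comp ih h

variable [IsNoetherianRing A] [PerfectRing (ResidueField A) p]
  (M : Type*) [AddCommGroup M] [Module A M] [Module.Finite A M]

theorem hLength_pushforward_sub_isBigO {n : ℕ} (hn : ringKrullDim A ≤ (n + 1 : ℕ))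
    (hF : (frobenius A p).Finite) {s : ℝ} (hs : 0 < s) (k : ℕ) :
    (fun e => hLength p A s (Pushforward (iterateFrobenius A p k) M) e - hLength p A s M (e + k))
      =O[atTop] fun e => (p : ℝ) ^ (e * n) := by
  have := Pushforward.finite (M := M) _ (finite_iterateFrobenius p hF k)
  have hp0 : (0 : ℝ) < p := by exact_mod_cast hp.out.pos
  set m := maximalIdeal A
  obtain ⟨c, hc⟩ := exists_pow_le_bracketPower_pow m (p ^ k)
  obtain ⟨C, hC⟩ := exists_colength_pow_add_le M hn (c + p ^ k)
  refine IsBigO.of_bound (C * (p ^ k) ^ n : ℕ) (Eventually.of_forall fun e => ?_)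
  have hmap : (hIdeal p A s e).map (iterateFrobenius A p k) =
      bracketPower m (p ^ k) ^ ⌈s * (p : ℝ) ^ e⌉₊ ⊔ bracketPower m (p ^ (e + k)) := by
    rw [hIdeal, Ideal.map_sup, Ideal.map_pow, ← bracketPower_eq_map, ← bracketPower_map,
      bracketPower_eq_map p m k, bracketPower_eq_map, bracketPower_eq_map, Ideal.map_map,
      add_comm e k, add_comm k e, iterateFrobenius_add]
  have h0 : hLength p A s (Pushforward (iterateFrobenius A p k) M) e =
      (colength (bracketPower m (p ^ k) ^ ⌈s * (p : ℝ) ^ e⌉₊ ⊔ bracketPower m (p ^ (e + k)))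
        M).toNat := by
    rw [hLength, Pushforward.colength_eq _ (residueField_map_iterateFrobenius_surjective p k), hmap]
  set T := ⌈s * (p : ℝ) ^ e⌉₊
  set t := ⌈s * (p : ℝ) ^ (e + k)⌉₊ with ht
  have hT1 : t ≤ p ^ k * T := by
    rw [ht, Nat.ceil_le, pow_add, Nat.cast_mul, Nat.cast_pow, mul_comm ((p : ℝ) ^ k), ← mul_assoc]
    gcongr
    exact Nat.le_ceil _
  have hT2 : p ^ k * T + c ≤ t + (c + p ^ k) := by
    have h1 : (T : ℝ) ≤ s * (p : ℝ) ^ e + 1 := (Nat.ceil_lt_add_one (by positivity)).le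
    have h2 : s * (p : ℝ) ^ (e + k) ≤ t := Nat.le_ceil _
    have h3 : (p : ℝ) ^ k * T ≤ t + p ^ k := by
      rw [pow_add] at h2
      have := mul_le_mul_of_nonneg_left h1 (pow_pos hp0 k).le
      nlinarith
    have h4 : p ^ k * T ≤ t + p ^ k := by exact_mod_cast h3
    omega
  have hle1 : bracketPower m (p ^ k) ^ T ≤ m ^ t :=
    (Ideal.pow_right_mono (bracketPower_le_pow m _) T).trans
      (by rw [← pow_mul]; exact Ideal.pow_le_pow_right hT1)
  have hle2 : m ^ (t + (c + p ^ k)) ≤ bracketPower m (p ^ k) ^ T :=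
    (Ideal.pow_le_pow_right hT2).trans (hc T)
  have e1 := colength_anti (sup_le_sup_right hle1 (bracketPower m (p ^ (e + k)))) M
  have e2 := (colength_anti (sup_le_sup_right hle2 (bracketPower m (p ^ (e + k)))) M).trans
    (hC (p ^ (e + k)) t (pow_pos hp.out.pos _))
  have f1 : colength (m ^ t ⊔ bracketPower m (p ^ (e + k))) M ≠ ⊤ :=
    colength_ne_top M (N := t) le_sup_left
  have f2 : colength (bracketPower m (p ^ k) ^ T ⊔ bracketPower m (p ^ (e + k))) M ≠ ⊤ :=
    colength_ne_top M (N := t + (c + p ^ k)) (hle2.trans le_sup_left)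
  have e1' := ENat.toNat_le_toNat e1 f2
  have e2' := ENat.toNat_le_toNat e2 (WithTop.add_ne_top.mpr ⟨f1, ENat.natCast_ne_top _⟩)
  rw [ENat.toNat_add f1 (ENat.natCast_ne_top _), ENat.toNat_natCast] at e2'
  have h5 : hLength p A s M (e + k) = (colength (m ^ t ⊔ bracketPower m (p ^ (e + k))) M).toNat :=
    rfl
  rw [h0, h5, Real.norm_of_nonneg (by rw [sub_nonneg]; exact_mod_cast e1'),
    Real.norm_of_nonneg (by positivity), sub_le_iff_le_add']
  have h6 : ((C * (p ^ k) ^ n : ℕ) : ℝ) * (p : ℝ) ^ (e * n) = ((C * (p ^ (e + k)) ^ n : ℕ) : ℝ) := by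
    push_cast
    rw [pow_mul, pow_add, mul_pow]; ring
  rw [h6]
  exact_mod_cast e2'

end Frobenius

section GenericSplitting

variable {A : Type*} [CommRing A] {M : Type*} [AddCommGroup M] [Module A M]

theorem exists_notMem_forall_smul_mem {P : Ideal A} [P.IsPrime] {W Q : Submodule A M} (hW : W.FG)
    (h : ∀ x ∈ W, ∃ a ∉ P, a • x ∈ Q) : ∃ a ∉ P, ∀ x ∈ W, a • x ∈ Q := by
  induction W, hW using Submodule.fg_induction with
  | singleton x =>
    obtain ⟨a, ha, hx⟩ := h x (Submodule.mem_span_singleton_self x)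
    refine ⟨a, ha, fun y hy => ?_⟩
    obtain ⟨b, rfl⟩ := Submodule.mem_span_singleton.mp hy
    rw [smul_comm]
    exact Q.smul_mem _ hx
  | sup W₁ W₂ _ _ h₁ h₂ =>
    obtain ⟨a, ha, h₁⟩ := h₁ fun x hx => h x (Submodule.mem_sup_left hx)
    obtain ⟨b, hb, h₂⟩ := h₂ fun x hx => h x (Submodule.mem_sup_right hx)
    refine ⟨a * b, fun hab => (Ideal.IsPrime.mem_or_mem ‹_› hab).elim ha hb, fun x hx => ?_⟩
    obtain ⟨y, hy, z, hz, rfl⟩ := Submodule.mem_sup.mp hx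
    rw [smul_add, mul_smul, mul_smul, smul_comm a b y]
    exact add_mem (Q.smul_mem _ (h₁ y hy)) (Q.smul_mem _ (h₂ z hz))

theorem exists_retraction_of_prime [IsNoetherian A M] {P : Ideal A} [hP : P.IsPrime] {c : A}
    (hc : c ∉ P) (hcP : ∀ a ∈ P, ∀ m : M, c • a • m = 0) (N : Submodule A M) :
    ∃ t ∉ P, ∃ f : M →ₗ[A] N, ∀ x : N, f x = t • x := by
  obtain ⟨C, ⟨u, hu, hCN⟩, hmax⟩ := set_has_maximal_iff_noetherian.mpr ‹IsNoetherian A M›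
    {C : Submodule A M | ∃ u ∉ P, ∀ x ∈ C ⊓ N, u • x = 0}
    ⟨⊥, 1, (Ideal.ne_top_iff_one P).mp hP.ne_top, fun x hx => by
      rw [bot_inf_eq, Submodule.mem_bot] at hx; rw [hx, smul_zero]⟩
  have hgen : ∀ x ∈ (⊤ : Submodule A M), ∃ a ∉ P, a • x ∈ N ⊔ C := by
    intro x _
    by_cases hx : x ∈ C
    · exact ⟨1, (Ideal.ne_top_iff_one P).mp hP.ne_top, by
        rw [one_smul]; exact Submodule.mem_sup_right hx⟩
    have hlt : C < C ⊔ Submodule.span A {x} := by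
      refine lt_of_le_of_ne le_sup_left fun h => hx ?_
      rw [h]
      exact Submodule.mem_sup_right (Submodule.mem_span_singleton_self x)
    have hns : ¬ ∀ y ∈ (C ⊔ Submodule.span A {x}) ⊓ N, ∃ a ∉ P, a • y ∈ (⊥ : Submodule A M) := by
      intro h
      obtain ⟨v, hv, hv'⟩ := exists_notMem_forall_smul_mem (IsNoetherian.noetherian _) h
      exact hmax _ ⟨v, hv, fun y hy => (Submodule.mem_bot A).mp (hv' y hy)⟩ hlt
    push Not at hns
    obtain ⟨y, ⟨hy, hyN⟩, hyns⟩ := hns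
    obtain ⟨z, hz, w, hw, rfl⟩ := Submodule.mem_sup.mp hy
    obtain ⟨a, rfl⟩ := Submodule.mem_span_singleton.mp hw
    refine ⟨a, fun ha => ?_, ?_⟩
    · refine hyns (u * c) (fun h => (hP.mem_or_mem h).elim hu hc) ?_
      have h1 : c • (z + a • x) = c • z := by rw [smul_add, hcP a ha, add_zero]
      rw [Submodule.mem_bot, mul_smul, h1]
      exact hCN _ ⟨C.smul_mem c hz, h1 ▸ N.smul_mem c hyN⟩
    · have : a • x = (z + a • x) - z := by abel
      rw [this]
      exact sub_mem (Submodule.mem_sup_left hyN) (Submodule.mem_sup_right hz)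
  obtain ⟨t, ht, htN⟩ := exists_notMem_forall_smul_mem (IsNoetherian.noetherian _) hgen
  let f₁ : M →ₗ[A] ↥(N ⊔ C) :=
    LinearMap.codRestrict (N ⊔ C) (LinearMap.lsmul A M t) fun x => htN x trivial
  let f₂ := (LinearMap.quotientInfEquivSupQuotient N C).symm
  let f₃ : (N ⧸ N.comap N.subtype ⊓ C.comap N.subtype) →ₗ[A] N :=
    Submodule.liftQ _ (LinearMap.lsmul A N u) fun x hx => by
      rw [LinearMap.mem_ker, LinearMap.lsmul_apply]
      exact Subtype.ext (hCN x ⟨hx.2, x.2⟩)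
  refine ⟨u * t, fun h => (hP.mem_or_mem h).elim hu ht,
    f₃ ∘ₗ f₂.toLinearMap ∘ₗ Submodule.mkQ _ ∘ₗ f₁, fun x => ?_⟩
  have h2 : f₂ (Submodule.Quotient.mk (f₁ x)) = Submodule.Quotient.mk (t • x) :=
    LinearMap.quotientInfEquivSupQuotient_symm_apply_left N C (f₁ x) (N.smul_mem t x.2)
  change f₃ (f₂ (Submodule.Quotient.mk (f₁ x))) = _
  rw [h2]
  change u • t • x = _
  rw [mul_smul]

variable (A) in
theorem exists_mem_minimalPrimes_notMem [IsNoetherianRing A] {P : Ideal A}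
    (hP : P ∈ minimalPrimes A) :
    ∃ c ∉ P, ∀ Q ∈ minimalPrimes A, Q ≠ P → c ∈ Q := by
  classical
  have hfin := minimalPrimes.finite_of_isNoetherianRing A
  have hPp : P.IsPrime := hP.1.1
  have h : ¬ ((hfin.toFinset.erase P).inf id ≤ P) := by
    rw [Ideal.IsPrime.inf_le' hPp]
    rintro ⟨Q, hQ, hle⟩
    rw [Finset.mem_erase, Set.Finite.mem_toFinset] at hQ
    exact hQ.1 (le_antisymm hle (hP.2 hQ.2.1 hle))
  obtain ⟨c, hc, hcP⟩ := SetLike.not_le_iff_exists.mp h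
  refine ⟨c, hcP, fun Q hQ hQP => ?_⟩
  have : (hfin.toFinset.erase P).inf id ≤ Q :=
    Finset.inf_le (f := id) (Finset.mem_erase.mpr ⟨hQP, hfin.mem_toFinset.mpr hQ⟩)
  exact this hc

theorem exists_retraction [IsNoetherianRing A] [IsNoetherian A M]
    (hM : ∀ a ∈ nilradical A, ∀ m : M, a • m = 0) (N : Submodule A M) :
    ∃ t, (∀ P ∈ minimalPrimes A, t ∉ P) ∧ ∃ f : M →ₗ[A] N, ∀ x : N, f x = t • x := by
  classical
  have hfin := minimalPrimes.finite_of_isNoetherianRing A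
  have h1 : ∀ P : minimalPrimes A, ∃ c ∉ P.1, ∀ Q ∈ minimalPrimes A, Q ≠ P.1 → c ∈ Q :=
    fun P => exists_mem_minimalPrimes_notMem A P.2
  choose c hc hcQ using h1
  have h2 : ∀ P : minimalPrimes A, ∃ t ∉ P.1, ∃ f : M →ₗ[A] N, ∀ x : N, f x = t • x := by
    intro P
    have : P.1.IsPrime := P.2.1.1
    refine exists_retraction_of_prime (hc P) (fun a ha m => ?_) N
    rw [← mul_smul]
    refine hM _ ?_ m
    rw [nilradical, Ideal.zero_eq_bot, ← Ideal.sInf_minimalPrimes, Submodule.mem_sInf]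
    intro Q hQ
    by_cases hQP : Q = P.1
    · exact hQP ▸ Ideal.mul_mem_left _ _ ha
    · exact Ideal.mul_mem_right _ _ (hcQ P Q hQ hQP)
  choose t ht f hf using h2
  have := hfin.fintype
  refine ⟨∑ P, c P * t P, fun Q hQ hmem => ?_, ∑ P, c P • f P, fun x => ?_⟩
  · have hQp : Q.IsPrime := hQ.1.1
    rw [← Finset.add_sum_erase _ _ (Finset.mem_univ (⟨Q, hQ⟩ : minimalPrimes A))] at hmem
    have h3 : ∑ P ∈ Finset.univ.erase (⟨Q, hQ⟩ : minimalPrimes A), c P * t P ∈ Q :=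
      Ideal.sum_mem _ fun P hP => Ideal.mul_mem_right _ _ (hcQ P Q hQ fun h =>
        (Finset.ne_of_mem_erase hP) (Subtype.ext h.symm))
    exact (hQp.mem_or_mem ((Ideal.add_mem_iff_left Q h3).mp hmem)).elim (hc ⟨Q, hQ⟩) (ht ⟨Q, hQ⟩)
  · rw [LinearMap.sum_apply, Finset.sum_smul]
    refine Finset.sum_congr rfl fun P _ => ?_
    rw [LinearMap.smul_apply, hf, mul_smul]

theorem exists_notMem_minimalPrimes [IsNoetherianRing A] {Q : Ideal A} [Q.IsPrime]
    (hQ : Q ∉ minimalPrimes A) : ∃ y ∈ Q, ∀ P ∈ minimalPrimes A, y ∉ P := by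
  by_contra! h
  have hfin := minimalPrimes.finite_of_isNoetherianRing A
  obtain ⟨P, hP, hle⟩ := (Ideal.subset_union_prime_finite hfin (f := id) ⊥ ⊥
    (fun P hP _ _ => hP.1.1) (I := Q)).mp (fun y hy => by
      obtain ⟨P, hP, hyP⟩ := h y hy
      exact Set.mem_biUnion hP hyP)
  exact hQ ((le_antisymm hle (hP.2 ⟨‹_›, bot_le⟩ hle) : Q = P) ▸ hP)

end GenericSplitting

section Additivity

variable (p : ℕ) [hp : Fact p.Prime] {A : Type*} [CommRing A] [IsLocalRing A] [IsNoetherianRing A]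

theorem hLength_sub_isBigO_of_nilradical {s : ℝ} {n : ℕ} (hn : ringKrullDim A ≤ (n + 1 : ℕ))
    {N M L : Type*} [AddCommGroup N] [AddCommGroup M] [AddCommGroup L] [Module A N] [Module A M]
    [Module A L] [Module.Finite A N] [Module.Finite A M] [Module.Finite A L]
    (hM : ∀ a ∈ nilradical A, ∀ m : M, a • m = 0) {f : N →ₗ[A] M} {g : M →ₗ[A] L}
    (hf : Function.Injective f) (hg : Function.Surjective g) (hfg : Function.Exact f g) :
    (fun e => hLength p A s M e - (hLength p A s N e + hLength p A s L e)) =O[atTop]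
      fun e => (p : ℝ) ^ (e * n) := by
  obtain ⟨t, ht, r, hr⟩ := exists_retraction hM (LinearMap.range f)
  let e₁ := LinearEquiv.ofInjective f hf
  let F : M →ₗ[A] N × L := (e₁.symm.toLinearMap ∘ₗ r).prod g
  have hFf : ∀ x, F (f x) = (t • x, 0) := by
    intro x
    have h1 : r (f x) = t • e₁ x := hr (e₁ x)
    change (e₁.symm (r (f x)), g (f x)) = _
    rw [h1, map_smul, e₁.symm_apply_apply, hfg.apply_apply_eq_zero]
  have hcoker : ∀ y : (N × L) ⧸ LinearMap.range F, t • y = 0 := by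
    intro y
    obtain ⟨⟨x, z⟩, rfl⟩ := Submodule.Quotient.mk_surjective _ y
    obtain ⟨m, rfl⟩ := hg z
    rw [← Submodule.Quotient.mk_smul, Submodule.Quotient.mk_eq_zero]
    refine ⟨t • m + f (x - (F m).1), ?_⟩
    rw [map_add, map_smul, hFf]
    ext
    · change t • (F m).1 + t • (x - (F m).1) = t • x
      rw [← smul_add, add_sub_cancel]
    · simp [F]
  refine (IsBigO.of_bound' (Eventually.of_forall fun e => ?_)).trans
    (hLength_isBigO_of_smul_eq_zero p s ((N × L) ⧸ LinearMap.range F) hn ht hcoker)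
  have h1 := hLength_le_add p s e hfg hg
  have h2 := hLength_le_add_cokernel p s e F
  have h3 := hLength_prod p s e (A := A) (N := N) (L := L)
  rw [Real.norm_eq_abs, Real.norm_of_nonneg (hLength_nonneg _ _ _ _), abs_le]
  constructor <;> linarith [hLength_nonneg (A := A) p s ((N × L) ⧸ LinearMap.range F) e]

theorem isBigO_of_shift {n k : ℕ} {u : ℕ → ℝ}
    (h : (fun e => u (e + k)) =O[atTop] fun e => (p : ℝ) ^ (e * n)) :
    u =O[atTop] fun e => (p : ℝ) ^ (e * n) := by
  have h1 := h.comp_tendsto (tendsto_sub_atTop_nat k)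
  refine (h1.trans (IsBigO.of_bound' (Eventually.of_forall fun e => ?_))).congr' ?_ .rfl
  · have : (1 : ℝ) ≤ p := by exact_mod_cast hp.out.one_le
    simp only [Function.comp_apply]
    rw [Real.norm_of_nonneg (by positivity), Real.norm_of_nonneg (by positivity)]
    exact pow_le_pow_right₀ this (Nat.mul_le_mul_right _ (Nat.sub_le e k))
  · filter_upwards [eventually_ge_atTop k] with e he
    simp [Nat.sub_add_cancel he]

variable [CharP A p] [PerfectRing (ResidueField A) p]

theorem hLength_sub_isBigO {s : ℝ} (hs : 0 < s) {n : ℕ} (hn : ringKrullDim A ≤ (n + 1 : ℕ))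
    (hF : (frobenius A p).Finite)
    {N M L : Type*} [AddCommGroup N] [AddCommGroup M] [AddCommGroup L] [Module A N] [Module A M]
    [Module A L] [Module.Finite A N] [Module.Finite A M] [Module.Finite A L]
    {f : N →ₗ[A] M} {g : M →ₗ[A] L}
    (hf : Function.Injective f) (hg : Function.Surjective g) (hfg : Function.Exact f g) :
    (fun e => hLength p A s M e - (hLength p A s N e + hLength p A s L e)) =O[atTop]
      fun e => (p : ℝ) ^ (e * n) := by
  obtain ⟨j, hj⟩ := IsNoetherianRing.isNilpotent_nilradical A
  have hk : j ≤ p ^ j := (Nat.lt_pow_self hp.out.one_lt).le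
  let φ := iterateFrobenius A p j
  have hφ := finite_iterateFrobenius p hF j
  have := Pushforward.finite (M := M) φ hφ
  have := Pushforward.finite (M := N) φ hφ
  have := Pushforward.finite (M := L) φ hφ
  have hnil : ∀ a ∈ nilradical A, ∀ m : Pushforward φ M, a • m = 0 := by
    intro a ha m
    have : φ a = 0 := by
      rw [iterateFrobenius_def, ← Ideal.mem_bot, ← Ideal.zero_eq_bot, ← hj]
      exact Ideal.pow_le_pow_right hk (Ideal.pow_mem_pow ha _)
    obtain ⟨m, rfl⟩ := (Pushforward.of φ).surjective m
    rw [Pushforward.smul_of, this, zero_smul, map_zero]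
  have h1 := hLength_sub_isBigO_of_nilradical p (s := s) hn hnil (f := Pushforward.map φ f)
    (g := Pushforward.map φ g) hf hg hfg
  have hMk := hLength_pushforward_sub_isBigO p M hn hF hs j
  have hNk := hLength_pushforward_sub_isBigO p N hn hF hs j
  have hLk := hLength_pushforward_sub_isBigO p L hn hF hs j
  refine isBigO_of_shift p (k := j) (((h1.sub hMk).add (hNk.add hLk)).congr_left fun e => ?_)
  ring

end Additivity

section Convergence

theorem exists_tendsto_of_abs_sub_le {b : ℕ → ℝ} {B C ρ θ : ℝ} (hB : ∀ e, |b e| ≤ B)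
    (hρ : 0 ≤ ρ) (hθ : 0 < θ) (hθ1 : θ < 1) (hC : ∀ e, |b (e + 1) - ρ * b e| ≤ C * θ ^ e) :
    ∃ l, Tendsto b atTop (𝓝 l) := by
  have hC0 : 0 ≤ C := by simpa using (abs_nonneg _).trans (hC 0)
  rcases lt_trichotomy ρ 1 with h | h | h
  · obtain ⟨σ, hσ, hσ1⟩ := exists_between (max_lt h hθ1)
    have hρσ : ρ < σ := (le_max_left _ _).trans_lt hσ
    have hθσ : θ < σ := (le_max_right _ _).trans_lt hσ
    set K := max |b 0| (C / (σ - ρ))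
    have hK : C ≤ K * (σ - ρ) := by
      rw [← div_le_iff₀ (sub_pos.mpr hρσ)]; exact le_max_right _ _
    have hσ0 : 0 < σ := hθ.trans hθσ
    have key : ∀ e, |b e| ≤ K * σ ^ e := by
      intro e
      induction e with
      | zero => rw [pow_zero, mul_one]; exact le_max_left _ _
      | succ e ih =>
        have h1 : |b (e + 1)| ≤ C * θ ^ e + ρ * |b e| := by
          have := abs_add_le (b (e + 1) - ρ * b e) (ρ * b e)
          rw [sub_add_cancel, abs_mul, abs_of_nonneg hρ] at this
          linarith [hC e]
        have h2 : C * θ ^ e ≤ C * σ ^ e := by gcongr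
        have h3 : ρ * |b e| ≤ ρ * (K * σ ^ e) := by gcongr
        have h4 : C * σ ^ e ≤ K * (σ - ρ) * σ ^ e := by gcongr
        calc _ ≤ _ := h1
          _ ≤ K * (σ - ρ) * σ ^ e + ρ * (K * σ ^ e) := by linarith
          _ = _ := by ring
    refine ⟨0, squeeze_zero_norm key ?_⟩
    simpa using (tendsto_pow_atTop_nhds_zero_of_lt_one hσ0.le hσ1).const_mul K
  · subst h
    refine cauchySeq_tendsto_of_complete (cauchySeq_of_le_geometric θ C hθ1 fun e => ?_)
    rw [dist_comm, Real.dist_eq]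
    simpa using hC e
  · have hρθ : 0 < ρ - θ := by linarith
    set K := C / (ρ - θ)
    have hK : K * (ρ - θ) = C := div_mul_cancel₀ _ hρθ.ne'
    have hK0 : 0 ≤ K := div_nonneg hC0 hρθ.le
    have step : ∀ e, ρ * (|b e| - K * θ ^ e) ≤ |b (e + 1)| - K * θ ^ (e + 1) := by
      intro e
      have h1 : ρ * |b e| ≤ |b (e + 1)| + C * θ ^ e := by
        have := abs_sub_abs_le_abs_sub (ρ * b e) (b (e + 1))
        rw [abs_mul, abs_of_nonneg hρ, abs_sub_comm] at this
        linarith [hC e]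
      rw [← hK] at h1
      rw [pow_succ]
      linarith
    have iter : ∀ e j, ρ ^ j * (|b e| - K * θ ^ e) ≤ B := by
      intro e j
      have h1 : ρ ^ j * (|b e| - K * θ ^ e) ≤ |b (e + j)| - K * θ ^ (e + j) := by
        induction j with
        | zero => simp
        | succ j ih =>
          rw [pow_succ', mul_assoc]
          exact (mul_le_mul_of_nonneg_left ih hρ).trans (step (e + j))
      linarith [hB (e + j), mul_nonneg hK0 (pow_nonneg hθ.le (e + j))]
    have key : ∀ e, |b e| ≤ K * θ ^ e := by
      intro e
      by_contra! hlt
      have hpos : 0 < |b e| - K * θ ^ e := by linarith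
      obtain ⟨j, hj⟩ := pow_unbounded_of_one_lt (B / (|b e| - K * θ ^ e)) h
      rw [div_lt_iff₀ hpos] at hj
      linarith [iter e j]
    refine ⟨0, squeeze_zero_norm key ?_⟩
    simpa using (tendsto_pow_atTop_nhds_zero_of_lt_one hθ.le hθ1).const_mul K

variable (p : ℕ) [hp : Fact p.Prime]

theorem tendsto_zero_of_isBigO {n : ℕ} {u : ℕ → ℝ}
    (h : u =O[atTop] fun e => (p : ℝ) ^ (e * n)) :
    Tendsto (fun e => u e / (p : ℝ) ^ (e * (n + 1))) atTop (𝓝 0) := by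
  have hp0 : (0 : ℝ) < p := by exact_mod_cast hp.out.pos
  have hp1 : (1 : ℝ) < p := by exact_mod_cast hp.out.one_lt
  have h1 : (fun e => u e / (p : ℝ) ^ (e * (n + 1))) =O[atTop] fun e => ((p : ℝ)⁻¹) ^ e := by
    refine (h.mul (isBigO_refl (fun e => ((p : ℝ) ^ (e * (n + 1)))⁻¹) atTop)).congr
      (fun e => (div_eq_mul_inv _ _).symm) fun e => ?_
    rw [mul_add, mul_one, pow_add, mul_inv, ← mul_assoc, mul_inv_cancel₀ (by positivity), one_mul,
      inv_pow]
  exact h1.trans_tendsto (tendsto_pow_atTop_nhds_zero_of_lt_one (by positivity)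
    (inv_lt_one_of_one_lt₀ hp1))

theorem exists_tendsto_of_recursion {n : ℕ} {u : ℕ → ℝ} {r : ℝ} (hr : 0 ≤ r)
    (hu : u =O[atTop] fun e => (p : ℝ) ^ (e * (n + 1)))
    (h : (fun e => u (e + 1) - r * u e) =O[atTop] fun e => (p : ℝ) ^ (e * n)) :
    ∃ l, Tendsto (fun e => u e / (p : ℝ) ^ (e * (n + 1))) atTop (𝓝 l) := by
  have hp0 : (0 : ℝ) < p := by exact_mod_cast hp.out.pos
  have hp1 : (1 : ℝ) < p := by exact_mod_cast hp.out.one_lt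
  obtain ⟨B, -, hB⟩ := bound_of_isBigO_nat_atTop hu
  obtain ⟨C, -, hC⟩ := bound_of_isBigO_nat_atTop h
  refine exists_tendsto_of_abs_sub_le (B := B) (C := C / (p : ℝ) ^ (n + 1))
    (ρ := r / (p : ℝ) ^ (n + 1)) (θ := (p : ℝ)⁻¹) (fun e => ?_) (by positivity) (by positivity)
    (inv_lt_one_of_one_lt₀ hp1) (fun e => ?_)
  · have := hB (x := e) (by positivity)
    rw [abs_div, abs_of_pos (a := (p : ℝ) ^ (e * (n + 1))) (by positivity),
      div_le_iff₀ (by positivity)]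
    rwa [Real.norm_eq_abs, Real.norm_of_nonneg (by positivity)] at this
  · have := hC (x := e) (by positivity)
    rw [Real.norm_eq_abs, Real.norm_of_nonneg (by positivity)] at this
    have h1 : u (e + 1) / (p : ℝ) ^ ((e + 1) * (n + 1)) -
        r / (p : ℝ) ^ (n + 1) * (u e / (p : ℝ) ^ (e * (n + 1))) =
        (u (e + 1) - r * u e) / (p : ℝ) ^ ((e + 1) * (n + 1)) := by
      rw [add_mul, one_mul, pow_add]
      field_simp
    rw [h1, abs_div, abs_of_pos (a := (p : ℝ) ^ ((e + 1) * (n + 1))) (by positivity),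
      div_le_iff₀ (by positivity)]
    refine this.trans_eq ?_
    rw [show (p : ℝ) ^ ((e + 1) * (n + 1)) = p ^ (e * n) * p ^ e * p ^ (n + 1) by ring, inv_pow]
    field_simp

variable {A : Type*} [CommRing A] [IsLocalRing A] [IsNoetherianRing A] [CharP A p]
  [PerfectRing (ResidueField A) p]

theorem exists_hLength_sub_mul_isBigO {s : ℝ} (hs : 0 < s) {n : ℕ}
    (hn : ringKrullDim A ≤ (n + 1 : ℕ)) (hF : (frobenius A p).Finite) {P : Ideal A}
    (hP : P ∈ minimalPrimes A) (M : Type*) [AddCommGroup M] [Module A M] [hM : Module.Finite A M]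
    (hPM : ∀ a ∈ P, ∀ m : M, a • m = 0) :
    ∃ r : ℕ, (fun e => hLength p A s M e - r * hLength p A s (A ⧸ P) e) =O[atTop]
      fun e => (p : ℝ) ^ (e * n) := by
  revert hPM
  refine IsNoetherianRing.induction_on_isQuotientEquivQuotientPrime A hM
    (motive := fun N _ _ _ => (∀ a ∈ P, ∀ m : N, a • m = 0) →
      ∃ r : ℕ, (fun e => hLength p A s N e - r * hLength p A s (A ⧸ P) e) =O[atTop]
        fun e => (p : ℝ) ^ (e * n)) ?_ ?_ ?_
  · intro N _ _ _ _ _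
    have h0 : (fun e => hLength p A s N e) =O[atTop] fun e => (p : ℝ) ^ (e * n) :=
      hLength_isBigO_of_smul_eq_zero p s N hn (y := 1)
        (fun Q hQ => (Ideal.ne_top_iff_one Q).mp hQ.1.1.ne_top) (fun m => Subsingleton.elim _ _)
    exact ⟨0, by simpa using h0⟩
  · intro N _ _ _ Q e hPN
    have hQp := Q.2
    by_cases hQ : Q.1 = P
    · refine ⟨1, ?_⟩
      rw [hLength_congr p s e, hQ]
      simpa using isBigO_zero _ _
    · have hPQ : P ≤ Q.1 := by
        intro a ha
        rw [← Ideal.Quotient.eq_zero_iff_mem]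
        have := hPN a ha (e.symm 1)
        rw [← map_smul, LinearEquiv.map_eq_zero_iff, Algebra.smul_def, mul_one] at this
        exact this
      obtain ⟨y, hyQ, hy⟩ := exists_notMem_minimalPrimes (A := A) (Q := Q.1)
        (fun h => hQ (le_antisymm (h.2 hP.1 hPQ) hPQ))
      have h0 : (fun e => hLength p A s N e) =O[atTop] fun e => (p : ℝ) ^ (e * n) :=
        hLength_isBigO_of_smul_eq_zero p s N hn hy (fun m => by
          apply e.injective
          rw [map_smul, map_zero]
          obtain ⟨z, hz⟩ := Ideal.Quotient.mk_surjective (e m)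
          rw [← hz, Algebra.smul_def, Ideal.Quotient.algebraMap_eq,
            Ideal.Quotient.eq_zero_iff_mem.mpr hyQ, zero_mul])
      exact ⟨0, by simpa using h0⟩
  · intro N₁ _ _ _ N₂ _ _ _ N₃ _ _ _ f g hf hg hfg h1 h3 hPN
    obtain ⟨r₁, h1⟩ := h1 fun a ha m => hf (by rw [map_smul, hPN a ha, map_zero])
    obtain ⟨r₃, h3⟩ := h3 fun a ha m => by
      obtain ⟨m, rfl⟩ := hg m
      rw [← map_smul, hPN a ha, map_zero]
    refine ⟨r₁ + r₃, ((hLength_sub_isBigO p hs hn hF hf hg hfg).add (h1.add h3)).congr_left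
      fun e => ?_⟩
    push_cast
    ring

omit [CharP A p] [PerfectRing (ResidueField A) p] in
theorem hLength_isBigO_succ {s : ℝ} {n : ℕ} (hn : ringKrullDim A ≤ (n + 1 : ℕ))
    (M : Type*) [AddCommGroup M] [Module A M] [Module.Finite A M] :
    hLength p A s M =O[atTop] fun e => (p : ℝ) ^ (e * (n + 1)) := by
  obtain ⟨t, ht, hc, N, hN⟩ := exists_finset_parameters A
  rw [← hc] at hn
  exact hLength_isBigO p s M (K := ⊥) (Submodule.bot_smul _) ht (by exact_mod_cast hn)
    (hN.trans le_sup_right)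

theorem exists_tendsto_hLength_quotient_prime {s : ℝ} (hs : 0 < s) {n : ℕ}
    (hn : ringKrullDim A ≤ (n + 1 : ℕ)) (hF : (frobenius A p).Finite) (P : Ideal A) [P.IsPrime] :
    ∃ l, Tendsto (fun e => hLength p A s (A ⧸ P) e / (p : ℝ) ^ (e * (n + 1))) atTop (𝓝 l) := by
  by_cases hP : P ∈ minimalPrimes A
  · have := Pushforward.finite (M := A ⧸ P) _ (finite_iterateFrobenius p hF 1)
    obtain ⟨r, hr⟩ := exists_hLength_sub_mul_isBigO p hs hn hF hP
      (Pushforward (iterateFrobenius A p 1) (A ⧸ P)) (fun a ha m => by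
        obtain ⟨m, rfl⟩ := (Pushforward.of (iterateFrobenius A p 1)).surjective m
        obtain ⟨z, rfl⟩ := Ideal.Quotient.mk_surjective m
        rw [Pushforward.smul_of, Algebra.smul_def, Ideal.Quotient.algebraMap_eq,
          Ideal.Quotient.eq_zero_iff_mem.mpr, zero_mul, map_zero]
        rw [iterateFrobenius_def, pow_one]
        exact Ideal.pow_mem_of_mem P ha p hp.out.pos)
    refine exists_tendsto_of_recursion p (Nat.cast_nonneg r) (hLength_isBigO_succ p hn _)
      ((hr.sub (hLength_pushforward_sub_isBigO p (A ⧸ P) hn hF hs 1)).congr_left fun e => ?_)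
    ring
  · obtain ⟨y, hyP, hy⟩ := exists_notMem_minimalPrimes hP
    refine ⟨0, tendsto_zero_of_isBigO p (hLength_isBigO_of_smul_eq_zero p s (A ⧸ P) hn hy
      fun m => ?_)⟩
    obtain ⟨z, rfl⟩ := Ideal.Quotient.mk_surjective m
    rw [Algebra.smul_def, Ideal.Quotient.algebraMap_eq,
      Ideal.Quotient.eq_zero_iff_mem.mpr hyP, zero_mul]

theorem exists_tendsto_hLength {s : ℝ} (hs : 0 < s) {n : ℕ}
    (hn : ringKrullDim A ≤ (n + 1 : ℕ)) (hF : (frobenius A p).Finite)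
    (M : Type*) [AddCommGroup M] [Module A M] [hM : Module.Finite A M] :
    ∃ l, Tendsto (fun e => hLength p A s M e / (p : ℝ) ^ (e * (n + 1))) atTop (𝓝 l) := by
  refine IsNoetherianRing.induction_on_isQuotientEquivQuotientPrime A hM
    (motive := fun N _ _ _ =>
      ∃ l, Tendsto (fun e => hLength p A s N e / (p : ℝ) ^ (e * (n + 1))) atTop (𝓝 l)) ?_ ?_ ?_
  · intro N _ _ _ _
    exact ⟨0, tendsto_zero_of_isBigO p (hLength_isBigO_of_smul_eq_zero p s N hn (y := 1)
      (fun Q hQ => (Ideal.ne_top_iff_one Q).mp hQ.1.1.ne_top) (fun m => Subsingleton.elim _ _))⟩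
  · intro N _ _ _ Q e
    have := Q.2
    rw [hLength_congr p s e]
    exact exists_tendsto_hLength_quotient_prime p hs hn hF Q.1
  · rintro N₁ _ _ _ N₂ _ _ _ N₃ _ _ _ f g hf hg hfg ⟨l₁, h₁⟩ ⟨l₃, h₃⟩
    refine ⟨0 + (l₁ + l₃), ((tendsto_zero_of_isBigO p
      (hLength_sub_isBigO p hs hn hF hf hg hfg)).add (h₁.add h₃)).congr fun e => ?_⟩
    ring

end Convergence

section CoefficientField

open Polynomial

variable {A k : Type*} [CommRing A] [Field k] (π : A →+* k)

theorem isUnit_of_ker_pow_two_eq_bot (hπ : Function.Surjective π) (h2 : RingHom.ker π ^ 2 = ⊥)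
    {x : A} (hx : π x ≠ 0) : IsUnit x := by
  obtain ⟨y, hy⟩ := hπ (π x)⁻¹
  have h1 : x * y - 1 ∈ RingHom.ker π := by
    rw [RingHom.mem_ker, map_sub, map_mul, hy, mul_inv_cancel₀ hx, map_one, sub_self]
  have h3 : (x * y - 1) ^ 2 = 0 := by
    rw [← Ideal.mem_bot, ← h2]
    exact Ideal.pow_mem_pow h1 2
  have h4 : IsUnit (x * y) := by
    have : IsNilpotent (x * y - 1) := ⟨2, h3⟩
    have := this.isUnit_add_one
    rwa [sub_add_cancel] at this
  exact isUnit_of_mul_isUnit_left h4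

theorem isField_subring_of_frobenius_range_le {p : ℕ} [hp : Fact p.Prime] [CharP A p]
    (hπ : Function.Surjective π)
    (h2 : RingHom.ker π ^ 2 = ⊥) {K : Subring A} (hK : (frobenius A p).range ≤ K)
    (hK0 : ∀ x ∈ K, π x = 0 → x = 0) : IsField K := by
  have hnt : Nontrivial A := π.domain_nontrivial
  refine ⟨⟨0, 1, zero_ne_one⟩, mul_comm, fun {a} ha => ?_⟩
  obtain ⟨u, hu⟩ := isUnit_of_ker_pow_two_eq_bot π hπ h2
    (x := a.1) fun h => ha (Subtype.ext (hK0 _ a.2 h))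
  have h1 : (↑u⁻¹ : A) ^ p ∈ K := hK ⟨↑u⁻¹, rfl⟩
  refine ⟨⟨a.1 ^ (p - 1) * (↑u⁻¹ : A) ^ p, K.mul_mem (K.pow_mem a.2 _) h1⟩, Subtype.ext ?_⟩
  change a.1 * (a.1 ^ (p - 1) * (↑u⁻¹ : A) ^ p) = 1
  rw [← mul_assoc, mul_pow_sub_one hp.out.ne_zero, ← hu, ← mul_pow, Units.mul_inv, one_pow]

theorem exists_subring_bijective (p : ℕ) [hp : Fact p.Prime] [CharP A p]
    (hπ : Function.Surjective π) (h2 : RingHom.ker π ^ 2 = ⊥) :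
    ∃ K : Subring A, Function.Bijective (π.comp K.subtype) := by
  have hnt : Nontrivial A := π.domain_nontrivial
  have hfrob : ∀ x, π x = 0 → x ^ p = 0 := fun x hx => by
    have : x ^ 2 = 0 := by
      rw [← Ideal.mem_bot, ← h2]
      exact Ideal.pow_mem_pow hx 2
    rw [← Nat.sub_add_cancel hp.out.two_le, pow_add, this, mul_zero]
  obtain ⟨K, -, ⟨hK, hK0⟩, hmax⟩ := zorn_le_nonempty₀
    {K : Subring A | (frobenius A p).range ≤ K ∧ ∀ x ∈ K, π x = 0 → x = 0}
    (fun c hc hchain K₀ hK₀ => ⟨sSup c, ⟨(hc hK₀).1.trans (le_sSup hK₀), fun x hx => by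
      obtain ⟨K, hK, hxK⟩ := (Subring.mem_sSup_of_directedOn ⟨K₀, hK₀⟩ hchain.directedOn).mp hx
      exact (hc hK).2 x hxK⟩, fun K hK => le_sSup hK⟩)
    (frobenius A p).range ⟨le_rfl, by
      rintro _ ⟨x, rfl⟩ hx
      rw [frobenius_def, map_pow] at hx
      exact hfrob x (eq_zero_of_pow_eq_zero hx)⟩
  let := (isField_subring_of_frobenius_range_le π hπ h2 hK hK0).toField
  refine ⟨K, RingHom.injective _, fun y => ?_⟩
  obtain ⟨t, rfl⟩ := hπ y
  by_contra hy
  push Not at hy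
  have htp : t ^ p ∈ K := hK ⟨t, rfl⟩
  have hirr : Irreducible (X ^ p - C (⟨t ^ p, htp⟩ : K)) := by
    refine X_pow_sub_C_irreducible_of_prime hp.out fun b hb => hy b ?_
    have h1 : b.1 ^ p = t ^ p := congrArg Subtype.val hb
    have h3 : (b.1 - t) ^ p = 0 := by rw [sub_pow_char, h1, sub_self]
    have h4 : π (b.1 - t) = 0 := eq_zero_of_pow_eq_zero (by rw [← map_pow, h3, map_zero])
    rwa [map_sub, sub_eq_zero] at h4
  let ev : K[X] →+* A := eval₂RingHom K.subtype t
  have hev : ev (X ^ p - C (⟨t ^ p, htp⟩ : K)) = 0 := by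
    simp [ev]
  have hle : K ≤ ev.range := fun x hx => ⟨C ⟨x, hx⟩, by simp [ev]⟩
  have hmem : ev.range ∈ {K : Subring A | (frobenius A p).range ≤ K ∧ ∀ x ∈ K, π x = 0 → x = 0} := by
    refine ⟨hK.trans hle, ?_⟩
    rintro _ ⟨f, rfl⟩ hf
    by_contra h0
    obtain ⟨a, b, hab⟩ := (hirr.coprime_iff_not_dvd (n := f)).mpr fun ⟨g, hg⟩ => h0 (by
      rw [hg, map_mul, hev, zero_mul])
    have := congrArg π (congrArg ev hab)
    rw [map_add, map_mul, map_mul, hev, mul_zero, zero_add, map_mul, hf, mul_zero, map_one,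
      map_one] at this
    exact zero_ne_one this
  have ht : t ∈ K := hmax hmem hle ⟨X, by simp [ev]⟩
  exact hy ⟨t, ht⟩ rfl

theorem exists_ringHom_section (p : ℕ) [hp : Fact p.Prime] [CharP A p]
    (hπ : Function.Surjective π) (h2 : RingHom.ker π ^ 2 = ⊥) :
    ∃ σ : k →+* A, π.comp σ = RingHom.id k := by
  obtain ⟨K, hK⟩ := exists_subring_bijective π p hπ h2
  let e := RingEquiv.ofBijective _ hK
  refine ⟨K.subtype.comp e.symm.toRingHom, RingHom.ext fun x => ?_⟩
  exact e.apply_symm_apply x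

theorem formallySmooth_zmod (p : ℕ) [hp : Fact p.Prime] (k : Type*) [Field k] [Algebra (ZMod p) k] :
    Algebra.FormallySmooth (ZMod p) k := by
  refine Algebra.FormallySmooth.of_comp_surjective fun B _ _ I hI f => ?_
  let mk := Ideal.Quotient.mkₐ (ZMod p) I
  let D : Subring (k × B) := RingHom.eqLocus ((f : k →+* B ⧸ I).comp (RingHom.fst k B))
    ((mk : B →+* B ⧸ I).comp (RingHom.snd k B))
  have hpk : (p : k) = 0 := by
    rw [← map_natCast (algebraMap (ZMod p) k), CharP.cast_eq_zero, map_zero]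
  have hpB : (p : B) = 0 := by
    rw [← map_natCast (algebraMap (ZMod p) B), CharP.cast_eq_zero, map_zero]
  have : CharP D p := (CharP.charP_iff_prime_eq_zero hp.out).mpr (Subtype.ext (Prod.ext hpk hpB))
  let π : D →+* k := (RingHom.fst k B).comp D.subtype
  obtain ⟨σ, hσ⟩ := exists_ringHom_section π p (fun x => by
      obtain ⟨b, hb⟩ := Ideal.Quotient.mk_surjective (f x)
      exact ⟨⟨(x, b), hb.symm⟩, rfl⟩) (by
    have hker : ∀ x ∈ RingHom.ker π, x.1.1 = 0 ∧ x.1.2 ∈ I := fun x hx => by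
      have h1 : x.1.1 = 0 := hx
      have h3 : f x.1.1 = mk x.1.2 := x.2
      rw [h1, map_zero] at h3
      exact ⟨h1, Ideal.Quotient.eq_zero_iff_mem.mp h3.symm⟩
    rw [eq_bot_iff, pow_two, Ideal.mul_le]
    intro x hx y hy
    refine (Ideal.mem_bot).mpr (Subtype.ext (Prod.ext ?_ ?_))
    · change x.1.1 * y.1.1 = 0
      rw [(hker x hx).1, zero_mul]
    · change x.1.2 * y.1.2 = 0
      rw [← Ideal.mem_bot, ← hI, pow_two]
      exact Ideal.mul_mem_mul (hker x hx).2 (hker y hy).2)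
  let τ : k →+* B := (RingHom.snd k B).comp (D.subtype.comp σ)
  have hτ := Subsingleton.elim (τ.comp (algebraMap (ZMod p) k)) (algebraMap (ZMod p) B)
  refine ⟨⟨τ, RingHom.congr_fun hτ⟩, AlgHom.ext fun x => ?_⟩
  have h1 : f (σ x).1.1 = mk (σ x).1.2 := (σ x).2
  have h3 : (σ x).1.1 = x := RingHom.congr_fun hσ x
  rw [h3] at h1
  exact h1.symm

theorem exists_coefficientField (p : ℕ) [Fact p.Prime] (S : Type*) [CommRing S] [IsLocalRing S]
    [CharP S p] [IsAdicComplete (maximalIdeal S) S] :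
    ∃ σ : ResidueField S →+* S, (residue S).comp σ = RingHom.id _ := by
  let := ZMod.algebra S p
  let : Algebra (ZMod p) (ResidueField S) := ((residue S).comp (algebraMap (ZMod p) S)).toAlgebra
  have := formallySmooth_zmod p (ResidueField S)
  obtain ⟨g, hg⟩ := Algebra.FormallySmooth.exists_mkₐ_comp_eq_of_isAdicComplete
    (R := ZMod p) (A := ResidueField S) (S := S) (I := maximalIdeal S)
    ⟨RingHom.id (ResidueField S), fun r => rfl⟩
  exact ⟨g, RingHom.ext fun x => congr($hg x)⟩

end CoefficientField

section PowerSeriesExtension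

open MvPowerSeries

theorem MvPowerSeries.mem_span_range_X_pow {σ k : Type*} [Finite σ] [CommRing k] {N : ℕ}
    {f : MvPowerSeries σ k} (hf : ∀ n, n.degree < N → coeff n f = 0) :
    f ∈ (Ideal.span (Set.range X) : Ideal (MvPowerSeries σ k)) ^ N := by
  let P := MvPolynomial σ k
  let e := (toAdicCompletionAlgEquiv σ k).toLinearEquiv
  have h1 : e f ∈ (AdicCompletion.eval (MvPolynomial.idealOfVars σ k) P N).ker := by
    rw [LinearMap.mem_ker]
    change (Submodule.Quotient.mk (truncTotal N f) : P ⧸ _) = 0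
    have : truncTotal N f = 0 := by
      ext n
      by_cases hn : n.degree < N
      · rw [coeff_truncTotal _ hn, hf n hn, MvPolynomial.coeff_zero]
      · rw [coeff_truncTotal_eq_zero _ (not_lt.mp hn), MvPolynomial.coeff_zero]
    rw [this, Submodule.Quotient.mk_zero]
  rw [← AdicCompletion.pow_smul_top_eq_ker_eval (MvPolynomial.idealOfVars_fg σ k)] at h1
  have h2 := Submodule.mem_map_of_mem (f := e.symm.toLinearMap) h1
  rw [Submodule.map_smul'', LinearEquiv.coe_coe, e.symm_apply_apply, Submodule.map_top,
    LinearEquiv.range, Ideal.smul_top_eq_map, Submodule.restrictScalars_mem] at h2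
  have h3 : (MvPolynomial.idealOfVars σ k).map (algebraMap P (MvPowerSeries σ k)) =
      Ideal.span (Set.range X) := by
    rw [MvPolynomial.idealOfVars, Ideal.map_span, ← Set.range_comp]
    congr 2
    ext1 i
    exact MvPolynomial.coe_X i
  rwa [Ideal.map_pow, h3] at h2

theorem MvPowerSeries.maximalIdeal_eq_span_range_X (σ k : Type*) [Finite σ] [Field k] :
    maximalIdeal (MvPowerSeries σ k) = Ideal.span (Set.range X) := by
  refine le_antisymm (fun f hf => ?_) ?_
  · rw [← pow_one (Ideal.span _)]
    refine mem_span_range_X_pow fun n hn => ?_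
    rw [(Finsupp.degree_eq_zero_iff n).mp (Nat.lt_one_iff.mp hn)]
    by_contra h
    exact (mem_maximalIdeal f).mp hf (isUnit_iff_constantCoeff.mpr (Ne.isUnit h))
  · rw [Ideal.span_le]
    rintro _ ⟨i, rfl⟩
    rw [SetLike.mem_coe, mem_maximalIdeal, mem_nonunits_iff, isUnit_iff_constantCoeff]
    simp

theorem MvPowerSeries.flat_of_field (σ k k' : Type*) [Finite σ] [Field k] [Field k'] [Algebra k k'] :
    Module.Flat (MvPowerSeries σ k) (MvPowerSeries σ k') := by
  classical
  set A := MvPowerSeries σ k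
  set B := MvPowerSeries σ k'
  have hcoeff : ∀ (a : A) (b : B) n, coeff n (a • b) =
      ∑ x ∈ Finset.HasAntidiagonal.antidiagonal n, coeff x.1 a • coeff x.2 b := fun a b n => by
    rw [Algebra.smul_def, coeff_mul]
    refine Finset.sum_congr rfl fun x _ => ?_
    rw [Algebra.smul_def]
    rfl
  let v := Module.Basis.ofVectorSpace k k'
  let Λ (j) : B →ₗ[A] A :=
    { toFun := fun b n => v.repr (coeff n b) j
      map_add' := fun b c => by
        ext n
        change v.repr (coeff n (b + c)) j = v.repr (coeff n b) j + v.repr (coeff n c) j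
        rw [map_add, map_add, Finsupp.add_apply]
      map_smul' := fun a b => by
        ext n
        change v.repr (coeff n (a • b)) j =
          coeff n (a * show A from fun n => v.repr (coeff n b) j)
        rw [hcoeff, coeff_mul, map_sum, Finsupp.finsetSum_apply]
        refine Finset.sum_congr rfl fun x _ => ?_
        rw [map_smul, Finsupp.smul_apply, smul_eq_mul]
        rfl }
  refine Module.Flat.of_forall_isTrivialRelation fun {l f x} hfx => ?_
  let φ : (Fin l → A) →ₗ[A] A := Fintype.linearCombination A f
  obtain ⟨m, z, hz⟩ := Submodule.fg_iff_exists_fin_generating_family.mp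
    (IsNoetherian.noetherian (LinearMap.ker φ))
  let ι : (Fin l → A) →ₗ[A] (Fin l → B) := (Algebra.linearMap A B).compLeft (Fin l)
  let W : Submodule B (Fin l → B) := Submodule.span B (Set.range (ι ∘ z))
  have hι : ∀ y ∈ LinearMap.ker φ, ι y ∈ W := by
    intro y hy
    rw [← hz] at hy
    have := Submodule.mem_map_of_mem (f := ι) hy
    rw [Submodule.map_span, ← Set.range_comp] at this
    exact Submodule.span_le_restrictScalars A B _ this
  have hmem : ∀ N, ∃ w ∈ W, ∀ i n, n.degree < N → coeff n (x i - w i) = 0 := by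
    intro N
    have hfin : {n : σ →₀ ℕ | n.degree < N}.Finite := Finsupp.finite_of_degree_lt N
    let J := hfin.toFinset.biUnion fun n => Finset.univ.biUnion fun i =>
      (v.repr (coeff n (x i))).support
    have hΛ : ∀ j, (fun i => Λ j (x i)) ∈ LinearMap.ker φ := fun j => by
      rw [LinearMap.mem_ker, Fintype.linearCombination_apply]
      have := congrArg (Λ j) hfx
      rw [map_sum, map_zero] at this
      rw [← this]
      refine Finset.sum_congr rfl fun i _ => ?_
      rw [map_smul, smul_eq_mul, smul_eq_mul, mul_comm]
    refine ⟨∑ j ∈ J, (C (v j) : B) • ι fun i => Λ j (x i),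
      Submodule.sum_mem _ fun j _ => W.smul_mem _ (hι _ (hΛ j)), fun i n hn => ?_⟩
    rw [map_sub, sub_eq_zero, Finset.sum_apply, map_sum]
    have h1 : ∀ j, coeff n (((C (v j) : B) • ι fun i => Λ j (x i)) i) =
        v.repr (coeff n (x i)) j • v j := fun j => by
      change coeff n ((C (v j) : B) * algebraMap A B (Λ j (x i))) = _
      rw [coeff_C_mul, mul_comm, Algebra.smul_def]
      rfl
    simp_rw [h1]
    conv_lhs => rw [← v.linearCombination_repr (coeff n (x i)), Finsupp.linearCombination_apply]
    refine Finsupp.sum_of_support_subset _ (fun j hj => ?_) _ fun _ _ => zero_smul _ _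
    exact Finset.mem_biUnion.mpr ⟨n, hfin.mem_toFinset.mpr hn,
      Finset.mem_biUnion.mpr ⟨i, Finset.mem_univ i, hj⟩⟩
  have hxW : x ∈ W := by
    rw [← Submodule.Quotient.mk_eq_zero]
    refine IsHausdorff.haus (I := maximalIdeal B) inferInstance _ fun N => ?_
    obtain ⟨w, hw, hxw⟩ := hmem N
    rw [SModEq.zero]
    have h1 : x - w ∈ maximalIdeal B ^ N • (⊤ : Submodule B (Fin l → B)) := by
      rw [← Finset.univ_sum_single (x - w)]
      refine Submodule.sum_mem _ fun i _ => ?_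
      rw [← mul_one ((x - w) i), ← smul_eq_mul, Pi.single_smul]
      refine Submodule.smul_mem_smul ?_ Submodule.mem_top
      rw [maximalIdeal_eq_span_range_X]
      exact mem_span_range_X_pow (hxw i)
    have h2 : (Submodule.Quotient.mk x : (Fin l → B) ⧸ W) = W.mkQ (x - w) := by
      rw [map_sub, Submodule.mkQ_apply, Submodule.mkQ_apply, (Submodule.Quotient.mk_eq_zero W).mpr hw,
        sub_zero]
    rw [h2]
    have := Submodule.mem_map_of_mem (f := W.mkQ) h1
    rw [Submodule.map_smul''] at this
    exact Submodule.smul_mono le_rfl le_top this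
  obtain ⟨y, hy⟩ := (Submodule.mem_span_range_iff_exists_fun B).mp hxW
  refine ⟨m, fun i j => z j i, y, fun i => ?_, fun j => ?_⟩
  · rw [← hy, Finset.sum_apply]
    refine Finset.sum_congr rfl fun j _ => ?_
    rw [Algebra.smul_def, mul_comm]
    rfl
  · have : z j ∈ LinearMap.ker φ := hz ▸ Submodule.subset_span ⟨j, rfl⟩
    rw [LinearMap.mem_ker, Fintype.linearCombination_apply] at this
    simpa [mul_comm] using this

theorem RingHom.finite_of_forall_eq_sum {A B : Type*} [CommRing A] [CommRing B] {f : A →+* B}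
    {ι : Type*} (t : Finset ι) (u : ι → B) (h : ∀ b, ∃ c : ι → A, b = ∑ i ∈ t, f (c i) * u i) :
    f.Finite := by
  classical
  let := f.toAlgebra
  refine ⟨⟨t.image u, eq_top_iff.mpr fun b _ => ?_⟩⟩
  obtain ⟨c, rfl⟩ := h b
  exact Submodule.sum_mem _ fun i hi => Submodule.smul_mem _ (c i)
    (Submodule.subset_span (Finset.mem_coe.mpr (Finset.mem_image_of_mem u hi)))

theorem MvPowerSeries.finite_frobenius (σ k : Type*) [Finite σ] [Field k] (p : ℕ)
    [hp : Fact p.Prime] [CharP k p] [PerfectRing k p] [CharP (MvPowerSeries σ k) p] :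
    (frobenius (MvPowerSeries σ k) p).Finite := by
  classical
  let B := MvPowerSeries σ k
  have hp0 := hp.out.ne_zero
  have hfin : {n : σ →₀ ℕ | ∀ i, n i < p}.Finite := by
    have := Fintype.ofFinite σ
    refine (Finsupp.finite_of_degree_le (Fintype.card σ * p)).subset fun n hn => ?_
    rw [Set.mem_ofPred_eq, Finsupp.degree_eq_sum]
    exact (Finset.sum_le_card_nsmul _ _ p fun i _ => (hn i).le).trans_eq (by simp)
  refine RingHom.finite_of_forall_eq_sum hfin.toFinset (fun n => monomial n (1 : k)) fun f => ?_
  let g (α : σ →₀ ℕ) : B := fun n => (frobeniusEquiv k p).symm (coeff (p • n + α) f)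
  refine ⟨g, MvPowerSeries.ext fun n => ?_⟩
  rw [map_sum]
  have h1 : ∀ α, coeff n (frobenius B p (g α) * (monomial α 1 : B)) =
      if α ≤ n then coeff (n - α) (((g α).expand p hp0).map (frobenius k p)) else 0 := fun α => by
    rw [map_frobenius_expand, frobenius_def, coeff_mul_monomial, mul_one]
  rw [Finset.sum_congr rfl fun α _ => h1 α]
  let r : σ →₀ ℕ := n.mapRange (· % p) (Nat.zero_mod p)
  let q : σ →₀ ℕ := n.mapRange (· / p) (Nat.zero_div p)
  have hn : n = p • q + r := by
    ext i
    exact (Nat.div_add_mod (n i) p).symm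
  rw [Finset.sum_eq_single r]
  · rw [if_pos (hn ▸ le_add_self), coeff_map]
    have : n - r = p • q := by rw [hn, add_tsub_cancel_right]
    rw [this, coeff_expand_smul]
    change _ = frobenius k p ((frobeniusEquiv k p).symm (coeff (p • q + r) f))
    rw [← hn, ← frobeniusEquiv_apply, RingEquiv.apply_symm_apply]
  · intro α hα hαr
    split_ifs with hle
    · obtain ⟨i, hi⟩ : ∃ i, ¬ p ∣ (n - α) i := by
        by_contra! h
        refine hαr (Finsupp.ext fun i => ?_)
        have h2 := hle i
        have h3 := hfin.mem_toFinset.mp hα i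
        obtain ⟨c, hc⟩ := h i
        change α i = n i % p
        rw [Finsupp.tsub_apply] at hc
        rw [show n i = α i + p * c by omega, Nat.add_mul_mod_self_left, Nat.mod_eq_of_lt h3]
      rw [coeff_map, coeff_expand_of_not_dvd p hp0 _ hi, map_zero]
    · rfl
  · intro h
    exact (h (hfin.mem_toFinset.mpr fun i => Nat.mod_lt _ hp.out.pos)).elim

end PowerSeriesExtension

section PerfectResidueFieldExtension

open MvPowerSeries TensorProduct

theorem exists_mvPowerSeries_surjective {S k : Type*} [CommRing S] [IsLocalRing S]
    [IsAdicComplete (maximalIdeal S) S] [Field k] (hS : (maximalIdeal S).FG) (σ : k →+* S)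
    (hσ : Function.Surjective ((residue S).comp σ)) :
    ∃ (r : ℕ) (ψ : MvPowerSeries (Fin r) k →+* S), Function.Surjective ψ := by
  obtain ⟨r, y, hy⟩ := Submodule.fg_iff_exists_fin_generating_family.mp hS
  let φ : MvPolynomial (Fin r) k →+* S := MvPolynomial.eval₂Hom σ y
  have hφ : (MvPolynomial.idealOfVars (Fin r) k).map φ = maximalIdeal S := by
    rw [MvPolynomial.idealOfVars, Ideal.map_span, ← Set.range_comp, ← hy]
    congr 2
    ext i
    simp [φ]
  have hle : ∀ n, MvPolynomial.idealOfVars (Fin r) k ^ n ≤ (maximalIdeal S ^ n).comap φ := fun n => by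
    rw [← Ideal.map_le_iff_le_comap, Ideal.map_pow, hφ]
  let f (n : ℕ) : MvPowerSeries (Fin r) k →+* S ⧸ maximalIdeal S ^ n :=
    (Ideal.quotientMap _ φ (hle n)).comp (truncTotalAlgHom (Fin r) k n).toRingHom
  have hf : ∀ {m n : ℕ} (h : m ≤ n),
      (Ideal.Quotient.factorPow (maximalIdeal S) h).comp (f n) = f m := fun {m n} h => by
    ext a
    change Ideal.Quotient.mk _ (φ (truncTotal n a)) = Ideal.Quotient.mk _ (φ (truncTotal m a))
    rw [Ideal.Quotient.eq, ← map_sub]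
    exact hle m (truncTotal_sub_truncTotal_mem_pow_idealOfVars h le_rfl a)
  let ψ := IsAdicComplete.liftRingHom (maximalIdeal S) f hf
  have hψ : ∀ P : MvPolynomial (Fin r) k, ψ P = φ P := fun P => by
    rw [← sub_eq_zero]
    refine IsHausdorff.haus (I := maximalIdeal S) inferInstance _ fun n => ?_
    rw [SModEq.zero, smul_eq_mul, Ideal.mul_top, ← Ideal.Quotient.eq,
      IsAdicComplete.mk_liftRingHom]
    change Ideal.quotientMap _ φ (hle n) (truncTotalAlgHom (Fin r) k n
      (algebraMap (MvPolynomial (Fin r) k) (MvPowerSeries (Fin r) k) P)) = _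
    rw [AlgHom.commutes]
    rfl
  have hmap : (Ideal.span (Set.range X) : Ideal (MvPowerSeries (Fin r) k)).map ψ =
      maximalIdeal S := by
    rw [Ideal.map_span, ← Set.range_comp, ← hy]
    congr 2
    ext i
    rw [Function.comp_apply, ← MvPolynomial.coe_X, hψ]
    simp [φ]
  refine ⟨r, ψ, ?_⟩
  have : IsHausdorff ((Ideal.span (Set.range X) : Ideal (MvPowerSeries (Fin r) k)).map ψ) S := by
    rw [hmap]; infer_instance
  refine surjective_of_mk_map_comp_surjective (I := Ideal.span (Set.range X)) ψ fun z => ?_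
  obtain ⟨z, rfl⟩ := Ideal.Quotient.mk_surjective z
  obtain ⟨c, hc⟩ := hσ (residue S z)
  refine ⟨(MvPolynomial.C c : MvPolynomial (Fin r) k), ?_⟩
  rw [RingHom.comp_apply, hψ, Ideal.Quotient.eq, hmap]
  simpa [φ] using Ideal.Quotient.eq.mp hc

theorem exists_flat_extension_of_isAdicComplete.{u} {S : Type u} [CommRing S]
    [IsLocalRing S] [IsAdicComplete (maximalIdeal S) S] (hS : (maximalIdeal S).FG) (p : ℕ) [hp : Fact p.Prime]
    [CharP S p] :
    ∃ (S' : Type u) (_ : CommRing S') (_ : IsLocalRing S') (_ : IsNoetherianRing S')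
      (_ : CharP S' p) (_ : PerfectRing (ResidueField S') p) (_ : Algebra S S'),
      Module.Flat S S' ∧ (maximalIdeal S).map (algebraMap S S') = maximalIdeal S' ∧
        (frobenius S' p).Finite := by
  obtain ⟨σ, hσ⟩ := exists_coefficientField p S
  obtain ⟨r, ψ, hψ⟩ := exists_mvPowerSeries_surjective hS σ (fun x => ⟨x, RingHom.congr_fun hσ x⟩)
  let k := ResidueField S
  let k' := PerfectClosure k p
  let : Algebra k k' := (PerfectClosure.of k p).toAlgebra
  let A := MvPowerSeries (Fin r) k
  let B := MvPowerSeries (Fin r) k'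
  let : Algebra A S := ψ.toAlgebra
  have := flat_of_field (Fin r) k k'
  have hAB : IsLocalHom (algebraMap A B) := map.isLocalHom _
  have : Module.FaithfullyFlat A B := Module.FaithfullyFlat.of_flat_of_isLocalHom
  let S' := S ⊗[A] B
  let g : B →+* S' := Algebra.TensorProduct.includeRight.toRingHom
  have hgA : ∀ a : A, algebraMap S S' (ψ a) = g (algebraMap A B a) := fun a =>
    Algebra.TensorProduct.tmul_one_eq_one_tmul a
  have hg : Function.Surjective g := Algebra.TensorProduct.includeRight_surjective B hψ
  have hnt : Nontrivial S' := inferInstance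
  have hloc : IsLocalRing S' := IsLocalRing.of_surjective' g hg
  have hB : CharP B p := charP_of_injective_ringHom (f := (C : k' →+* B)) (RingHom.injective _) p
  have hS' : CharP S' p := (CharP.charP_iff_prime_eq_zero hp.out).mpr (by
    rw [← map_natCast g, CharP.cast_eq_zero, map_zero])
  have hgl : IsLocalHom g := .of_surjective g hg
  refine ⟨S', inferInstance, hloc, isNoetherianRing_of_surjective B S' g hg, hS',
    PerfectRing.ofSurjective _ p fun y => ?_, inferInstance, inferInstance, le_antisymm ?_ ?_, ?_⟩
  · obtain ⟨y, rfl⟩ := residue_surjective y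
    obtain ⟨b, rfl⟩ := hg y
    obtain ⟨d, hd⟩ := (PerfectRing.bijective_frobenius (R := k') (p := p)).2 (constantCoeff b)
    refine ⟨residue S' (g (C d)), ?_⟩
    rw [frobenius_def, ← map_pow, ← map_pow, ← map_pow, show d ^ p = _ from hd]
    rw [← sub_eq_zero, ← map_sub, ← map_sub, residue_eq_zero_iff]
    refine (map_mem_nonunits_iff g _).mpr ?_
    rw [mem_nonunits_iff, isUnit_iff_constantCoeff]
    simp
  · rw [Ideal.map_le_iff_le_comap]
    intro x hx
    obtain ⟨a, rfl⟩ := hψ x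
    rw [Ideal.mem_comap, hgA]
    refine (map_mem_nonunits_iff g _).mpr ((map_mem_nonunits_iff (algebraMap A B) _).mpr ?_)
    exact fun ha => (mem_maximalIdeal _).mp hx (ha.map ψ)
  · rw [← map_maximalIdeal_of_surjective g hg, maximalIdeal_eq_span_range_X, Ideal.map_span,
      Ideal.span_le]
    rintro _ ⟨_, ⟨i, rfl⟩, rfl⟩
    have hX : (X i : B) = algebraMap A B (X i) := (map_X _ i).symm
    rw [hX, ← hgA]
    refine Ideal.mem_map_of_mem _ ?_
    have : IsLocalHom ψ := .of_surjective ψ hψ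
    refine (map_mem_nonunits_iff ψ _).mpr ?_
    rw [mem_nonunits_iff, isUnit_iff_constantCoeff]
    simp
  · refine RingHom.Finite.of_comp_finite (f := g) ?_
    have : (frobenius S' p).comp g = g.comp (frobenius B p) :=
      RingHom.ext fun b => (map_pow g b p).symm
    rw [this]
    exact (RingHom.Finite.of_surjective g hg).comp (finite_frobenius (Fin r) k' p)

theorem exists_flat_extension.{u} (R : Type u) [CommRing R] [IsLocalRing R] [IsNoetherianRing R]
    (p : ℕ) [hp : Fact p.Prime] [CharP R p] :
    ∃ (R' : Type u) (_ : CommRing R') (_ : IsLocalRing R') (_ : IsNoetherianRing R')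
      (_ : CharP R' p) (_ : PerfectRing (ResidueField R') p) (_ : Algebra R R'),
      Module.Flat R R' ∧ (maximalIdeal R).map (algebraMap R R') = maximalIdeal R' ∧
        (frobenius R' p).Finite := by
  let S := AdicCompletion (maximalIdeal R) R
  have : CharP S p := (CharP.charP_iff_prime_eq_zero hp.out).mpr (by
    rw [← map_natCast (algebraMap R S), CharP.cast_eq_zero, map_zero])
  obtain ⟨R', i₁, i₂, i₃, i₄, i₅, i₆, hflat, hmax, hF⟩ :=
    exists_flat_extension_of_isAdicComplete (S := S)
      (by rw [AdicCompletion.maximalIdeal_eq_map]; exact (maximalIdeal R).fg_of_isNoetherianRing.map _) p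
  let : Algebra R R' := ((algebraMap S R').comp (algebraMap R S)).toAlgebra
  have : IsScalarTower R S R' := .of_algebraMap_eq fun _ => rfl
  refine ⟨R', i₁, i₂, i₃, i₄, i₅, inferInstance, Module.Flat.trans R S R', ?_, hF⟩
  rw [← hmax, AdicCompletion.maximalIdeal_eq_map, Ideal.map_map]
  rfl

end PerfectResidueFieldExtension

section BaseChange

open TensorProduct

variable {A A' : Type*} [CommRing A] [CommRing A'] [Algebra A A']

theorem ker_baseChange_mkQ_smul_top (I : Ideal A) (M : Type*) [AddCommGroup M] [Module A M] :
    LinearMap.ker ((I • (⊤ : Submodule A M)).mkQ.baseChange A') =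
      I.map (algebraMap A A') • (⊤ : Submodule A' (A' ⊗[A] M)) := by
  refine le_antisymm (fun x hx => ?_) ?_
  · obtain ⟨y, rfl⟩ := (lTensor_exact A' (LinearMap.exact_subtype_mkQ (I • (⊤ : Submodule A M)))
      (Submodule.mkQ_surjective _) x).mp hx
    clear hx
    induction y with
    | zero => rw [map_zero]; exact zero_mem _
    | add y z hy hz => rw [map_add]; exact add_mem hy hz
    | tmul r m =>
      obtain ⟨m, hm⟩ := m
      change r ⊗ₜ[A] m ∈ _
      induction hm using Submodule.smul_induction_on' with
      | smul a ha m _ =>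
        rw [tmul_smul, ← algebraMap_smul A' a (r ⊗ₜ[A] m)]
        exact Submodule.smul_mem_smul (Ideal.mem_map_of_mem _ ha) Submodule.mem_top
      | add x _ y _ hx hy => rw [tmul_add]; exact add_mem hx hy
  · rw [Ideal.map, Submodule.span_smul_eq, Submodule.set_smul_le_iff]
    rintro _ y ⟨a, ha, rfl⟩ -
    rw [LinearMap.mem_ker, map_smul, algebraMap_smul, ← LinearMap.map_smul_of_tower]
    induction y with
    | zero => simp
    | add y z hy hz => rw [smul_add, map_add, hy, hz, add_zero]
    | tmul r m =>
      rw [← tmul_smul, LinearMap.baseChange_tmul, Submodule.mkQ_apply,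
        (Submodule.Quotient.mk_eq_zero _).mpr (Submodule.smul_mem_smul ha Submodule.mem_top),
        tmul_zero]

theorem colength_baseChange [IsLocalRing A] [IsLocalRing A'] [Module.Flat A A']
    (hmax : (maximalIdeal A).map (algebraMap A A') = maximalIdeal A') (I : Ideal A) (M : Type*)
    [AddCommGroup M] [Module A M] :
    colength (I.map (algebraMap A A')) (A' ⊗[A] M) = colength I M := by
  have : IsLocalHom (algebraMap A A') :=
    ((local_hom_TFAE (algebraMap A A')).out 0 2).mpr hmax.le
  have h1 := IsLocalRing.length_baseChange A A' (M ⧸ (I • (⊤ : Submodule A M)))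
  rw [hmax] at h1
  have h2 : Module.length A' (A' ⧸ maximalIdeal A') = 1 := by
    rw [Module.length_eq_one_iff]
    exact isSimpleModule_iff_quot_maximal.mpr ⟨_, inferInstance, ⟨.refl _ _⟩⟩
  rw [h2, mul_one] at h1
  rw [colength, colength, ← h1, ← ker_baseChange_mkQ_smul_top]
  exact ((I • (⊤ : Submodule A M)).mkQ.baseChange A').quotKerEquivOfSurjective
    (LinearMap.lTensor_surjective A' (Submodule.mkQ_surjective _)) |>.length_eq

theorem ringKrullDim_le_of_map_maximalIdeal_eq [IsLocalRing A] [IsLocalRing A'] [IsNoetherianRing A]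
    [IsNoetherianRing A'] (hmax : (maximalIdeal A).map (algebraMap A A') = maximalIdeal A') :
    ringKrullDim A' ≤ ringKrullDim A := by
  have : IsLocalHom (algebraMap A A') :=
    ((local_hom_TFAE (algebraMap A A')).out 0 2).mpr hmax.le
  have : (maximalIdeal A').LiesOver (maximalIdeal A) :=
    ⟨(maximalIdeal_comap (algebraMap A A')).symm⟩
  have h := Ideal.height_le_height_add_of_liesOver (maximalIdeal A) (maximalIdeal A')
  have h0 : ((maximalIdeal A').map
      (Ideal.Quotient.mk ((maximalIdeal A).map (algebraMap A A')))).height = 0 := by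
    have : Nontrivial (A' ⧸ (maximalIdeal A).map (algebraMap A A')) := by
      rw [hmax]; exact Ideal.Quotient.nontrivial_iff.mpr Ideal.IsPrime.ne_top'
    rw [← hmax, Ideal.map_quotient_self, Ideal.height_bot]
  rw [h0, add_zero] at h
  rw [← maximalIdeal_height_eq_ringKrullDim, ← maximalIdeal_height_eq_ringKrullDim]
  exact_mod_cast h

variable (p : ℕ) [hp : Fact p.Prime]

omit [Algebra A A'] in
theorem hIdeal_map [IsLocalRing A] [IsLocalRing A'] [CharP A p] [CharP A' p] (f : A →+* A')
    (hmax : (maximalIdeal A).map f = maximalIdeal A') (s : ℝ) (e : ℕ) :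
    (hIdeal p A s e).map f = hIdeal p A' s e := by
  rw [hIdeal, Ideal.map_sup, Ideal.map_pow, ← bracketPower_map p, hmax, hIdeal]

theorem hLength_baseChange [IsLocalRing A] [IsLocalRing A'] [Module.Flat A A'] [CharP A p]
    [CharP A' p] (hmax : (maximalIdeal A).map (algebraMap A A') = maximalIdeal A') (s : ℝ)
    (M : Type*) [AddCommGroup M] [Module A M] :
    hLength p A' s (A' ⊗[A] M) = hLength p A s M := by
  ext e
  rw [hLength, hLength, ← hIdeal_map p _ hmax, colength_baseChange hmax]

end BaseChange

section GeneralCase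

universe u

variable (p : ℕ) [hp : Fact p.Prime] {A : Type u} [CommRing A] [IsLocalRing A] [IsNoetherianRing A]
  [CharP A p] {N M L : Type*} [AddCommGroup N] [AddCommGroup M] [AddCommGroup L] [Module A N]
  [Module A M] [Module A L] [Module.Finite A N] [Module.Finite A M] [Module.Finite A L]

omit hp [CharP A p] in
theorem exists_maximalIdeal_pow_eq_bot (hA : ringKrullDim A ≤ 0) :
    ∃ N, maximalIdeal A ^ N = ⊥ := by
  obtain ⟨t, -, hc, N, hN⟩ := exists_finset_parameters A
  rw [← hc] at hA
  have : t.card = 0 := Nat.le_zero.mp (by exact_mod_cast hA)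
  rw [Finset.card_eq_zero.mp this, Finset.coe_empty, Ideal.span_empty] at hN
  exact ⟨N, le_bot_iff.mp hN⟩

omit hp [IsLocalRing A] [IsNoetherianRing A] [CharP A p] in
theorem colength_bot (M : Type*) [AddCommGroup M] [Module A M] :
    colength (⊥ : Ideal A) M = Module.length A M :=
  (Submodule.quotEquivOfEqBot _ (Submodule.bot_smul _)).length_eq

omit [CharP A p] [Module.Finite A M] in
variable (M) in
theorem eventually_hLength_eq_length {s : ℝ} (hs : 0 < s) (hA : ringKrullDim A ≤ 0) :
    ∀ᶠ e in atTop, hLength p A s M e = ((Module.length A M).toNat : ℝ) := by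
  obtain ⟨N, hN⟩ := exists_maximalIdeal_pow_eq_bot hA
  have hp1 : (1 : ℝ) < p := by exact_mod_cast hp.out.one_lt
  have h1 : ∀ᶠ e in atTop, (N : ℝ) ≤ s * (p : ℝ) ^ e :=
    ((tendsto_pow_atTop_atTop_of_one_lt hp1).const_mul_atTop hs).eventually_ge_atTop _
  filter_upwards [h1, eventually_ge_atTop N] with e he heN
  have h2 : hIdeal p A s e = ⊥ := by
    rw [eq_bot_iff, ← hN, hIdeal]
    refine sup_le (Ideal.pow_le_pow_right ?_) ((bracketPower_le_pow _ _).trans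
      (Ideal.pow_le_pow_right (heN.trans (Nat.lt_pow_self hp.out.one_lt).le)))
    exact_mod_cast he.trans (Nat.le_ceil _)
  rw [hLength, h2, colength_bot]

variable (M) in
theorem exists_tendsto_hLength_div {s : ℝ} (hs : 0 < s) {d : ℕ} (hA : ringKrullDim A ≤ d) :
    ∃ l, Tendsto (fun e => hLength p A s M e / (p : ℝ) ^ (e * d)) atTop (𝓝 l) := by
  cases d with
  | zero =>
    refine ⟨((Module.length A M).toNat : ℝ), tendsto_const_nhds.congr' ?_⟩
    filter_upwards [eventually_hLength_eq_length p M hs (by exact_mod_cast hA)] with e he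
    rw [he, mul_zero, pow_zero, div_one]
  | succ n =>
    obtain ⟨A', _, _, _, _, _, _, hflat, hmax, hF⟩ := exists_flat_extension A p
    rw [← hLength_baseChange p hmax s M]
    exact exists_tendsto_hLength p hs ((ringKrullDim_le_of_map_maximalIdeal_eq hmax).trans hA) hF _

theorem tendsto_hLength_sub_div {s : ℝ} (hs : 0 < s) {d : ℕ} (hA : ringKrullDim A ≤ d)
    {f : N →ₗ[A] M} {g : M →ₗ[A] L}
    (hf : Function.Injective f) (hg : Function.Surjective g) (hfg : Function.Exact f g) :
    Tendsto (fun e => (hLength p A s M e - (hLength p A s N e + hLength p A s L e)) /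
      (p : ℝ) ^ (e * d)) atTop (𝓝 0) := by
  cases d with
  | zero =>
    have hA0 : ringKrullDim A ≤ 0 := by exact_mod_cast hA
    obtain ⟨k, hk⟩ := exists_maximalIdeal_pow_eq_bot hA0
    refine tendsto_const_nhds.congr' ?_
    filter_upwards [eventually_hLength_eq_length p M hs hA0, eventually_hLength_eq_length p N hs hA0,
      eventually_hLength_eq_length p L hs hA0] with e hM hN hL
    have hN' := colength_ne_top N hk.le
    have hL' := colength_ne_top L hk.le
    rw [colength_bot] at hN' hL'
    rw [hM, hN, hL, Module.length_eq_add_of_exact f g hf hg hfg, ENat.toNat_add hN' hL']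
    simp
  | succ n =>
    obtain ⟨A', _, _, _, _, _, _, hflat, hmax, hF⟩ := exists_flat_extension A p
    rw [← hLength_baseChange p hmax s M, ← hLength_baseChange p hmax s N,
      ← hLength_baseChange p hmax s L]
    exact tendsto_zero_of_isBigO p (hLength_sub_isBigO p hs
      ((ringKrullDim_le_of_map_maximalIdeal_eq hmax).trans hA) hF (f := f.baseChange A')
      (g := g.baseChange A') (Module.Flat.lTensor_preserves_injective_linearMap f hf)
      (LinearMap.lTensor_surjective A' hg) (Module.Flat.lTensor_exact A' hfg))

end GeneralCase

section Dimension

theorem ringKrullDim_eq_krullDimNat (A : Type*) [CommRing A] [IsLocalRing A] [IsNoetherianRing A] :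
    ringKrullDim A = (krullDimNat A : ℕ) := by
  obtain ⟨t, -, hc, -⟩ := exists_finset_parameters A
  rw [krullDimNat, ← hc]
  rfl

theorem length_le_ringKrullDim_of_ker_le {P R : Type*} [CommRing P] [CommRing R] {f : P →+* R}
    (hf : Function.Surjective f) (l : LTSeries (PrimeSpectrum P))
    (hl : RingHom.ker f ≤ l.head.asIdeal) : (l.length : WithBot ℕ∞) ≤ ringKrullDim R := by
  rw [← ringKrullDim_eq_of_ringEquiv (RingHom.quotientKerEquivOfSurjective hf),
    ringKrullDim_quotient]
  let l' : LTSeries (PrimeSpectrum.zeroLocus (R := P) (RingHom.ker f)) :=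
    LTSeries.mk l.length (fun i => ⟨l i, hl.trans (l.head_le i)⟩) (fun i j hij => l.strictMono hij)
  exact le_iSup (fun l : LTSeries (PrimeSpectrum.zeroLocus (R := P) (RingHom.ker f)) =>
    (l.length : WithBot ℕ∞)) l'

theorem ringKrullDim_le_max_of_injective {P R S : Type*} [CommRing P] [CommRing R] [CommRing S]
    {f : P →+* R} {g : P →+* S} (hf : Function.Surjective f) (hg : Function.Surjective g)
    (hfg : ∀ x, f x = 0 → g x = 0 → x = 0) :
    ringKrullDim P ≤ max (ringKrullDim R) (ringKrullDim S) := by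
  refine iSup_le fun l => ?_
  have hmul : RingHom.ker f * RingHom.ker g ≤ l.head.asIdeal := by
    rw [Ideal.mul_le]
    intro x hx y hy
    rw [hfg (x * y) (by rw [map_mul, hx, zero_mul]) (by rw [map_mul, hy, mul_zero])]
    exact zero_mem _
  rcases (Ideal.IsPrime.mul_le l.head.isPrime).mp hmul with h | h
  · exact (length_le_ringKrullDim_of_ker_le hf l h).trans (le_max_left _ _)
  · exact (length_le_ringKrullDim_of_ker_le hg l h).trans (le_max_right _ _)

end Dimension

section Limits

universe u

variable (p : ℕ) [hp : Fact p.Prime]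

theorem hLength_eq_of_surjective {P R : Type*} [CommRing P] [CommRing R] [IsLocalRing P]
    [IsLocalRing R] [CharP P p] [CharP R p] [Algebra P R]
    (h : Function.Surjective (algebraMap P R)) (s : ℝ) :
    hLength p P s R = hLength p R s R := by
  ext e
  have h1 := hIdeal_map p _ (map_maximalIdeal_of_surjective _ h) s e
  rw [hLength, hLength, colength, colength]
  have h2 : hIdeal p P s e • (⊤ : Submodule P R) =
      (hIdeal p R s e • (⊤ : Submodule R R)).restrictScalars P := by
    rw [Ideal.smul_top_eq_map, h1, smul_eq_mul, Ideal.mul_top]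
  rw [h2, ← Module.length_eq_of_surjective (S := P) (M := R ⧸ (hIdeal p R s e • (⊤ : Submodule R R))) h]
  rfl

variable {A : Type u} [CommRing A] [IsLocalRing A] [IsNoetherianRing A] [CharP A p] {s : ℝ}

theorem hasHLimit (hs : 0 < s) : HasHLimit p A s :=
  exists_tendsto_hLength_div p A hs (ringKrullDim_eq_krullDimNat A).le

theorem tendsto_hLength_div (hs : 0 < s) :
    Tendsto (fun e => hLength p A s A e / (p : ℝ) ^ (e * krullDimNat A)) atTop
      (𝓝 (hLocal p A s)) :=
  tendsto_nhds_limUnder (hasHLimit p hs)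

theorem tendsto_hLength_div_zero (hs : 0 < s) {d : ℕ} (hd : ringKrullDim A < d) :
    Tendsto (fun e => hLength p A s A e / (p : ℝ) ^ (e * d)) atTop (𝓝 0) := by
  rw [ringKrullDim_eq_krullDimNat] at hd
  obtain ⟨c, rfl⟩ : ∃ c, d = krullDimNat A + (c + 1) :=
    Nat.exists_eq_add_of_lt (by exact_mod_cast hd)
  have hp1 : (1 : ℝ) < p := by exact_mod_cast hp.out.one_lt
  have h1 := (tendsto_hLength_div p (A := A) hs).mul
    (tendsto_pow_atTop_nhds_zero_of_lt_one (r := ((p : ℝ) ^ (c + 1))⁻¹) (by positivity)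
      (inv_lt_one_of_one_lt₀ (one_lt_pow₀ hp1 c.succ_ne_zero)))
  rw [mul_zero] at h1
  refine h1.congr fun e => ?_
  rw [inv_pow, ← pow_mul, ← div_eq_mul_inv, div_div, ← pow_add]
  ring_nf

end Limits

section FibreProduct

universe u

variable (p : ℕ) [hp : Fact p.Prime] {P : Type u} {R S T : Type*} [CommRing P] [CommRing R]
  [CommRing S] [CommRing T] [IsLocalRing P] [IsLocalRing R] [IsLocalRing S] [IsLocalRing T]
  [IsNoetherianRing P] [CharP P p] [CharP R p] [CharP S p] [CharP T p]

theorem tendsto_hLength_fiberProduct {s : ℝ} (hs : 0 < s) {d : ℕ} (hd : ringKrullDim P ≤ d)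
    {εR : R →+* T} {εS : S →+* T} {πR : P →+* R} {πS : P →+* S} (hεR : Function.Surjective εR)
    (hπR : Function.Surjective πR) (hπS : Function.Surjective πS)
    (hinj : ∀ x, πR x = 0 → πS x = 0 → x = 0) (hcomm : εR.comp πR = εS.comp πS)
    (hpull : ∀ r x, εR r = εS x → ∃ y, πR y = r ∧ πS y = x) :
    Tendsto (fun e => (hLength p P s P e + hLength p T s T e -
      (hLength p R s R e + hLength p S s S e)) / (p : ℝ) ^ (e * d)) atTop (𝓝 0) := by
  let := πR.toAlgebra
  let := πS.toAlgebra
  let := (εR.comp πR).toAlgebra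
  let πR' : P →ₗ[P] R := Algebra.linearMap P R
  let πS' : P →ₗ[P] S := Algebra.linearMap P S
  have hεR' : ∀ (a : P) (r : R), εR (πR a * r) = εR (πR a) * εR r := fun a r => map_mul _ _ _
  have hεS' : ∀ (a : P) (x : S), εS (πS a * x) = εR (πR a) * εS x := fun a x => by
    rw [map_mul]
    exact congrArg (· * _) (RingHom.congr_fun hcomm a).symm
  let εR' : R →ₗ[P] T := { εR with map_smul' := hεR' }
  let εS' : S →ₗ[P] T := { εS with map_smul' := hεS' }
  have : Module.Finite P R := .of_surjective πR' hπR
  have : Module.Finite P S := .of_surjective πS' hπS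
  have : Module.Finite P T := .of_surjective (εR' ∘ₗ πR') (hεR.comp hπR)
  have h1 := tendsto_hLength_sub_div p hs hd (f := πR'.prod πS')
    (g := εR' ∘ₗ LinearMap.fst P R S - εS' ∘ₗ LinearMap.snd P R S)
    (by
      rw [← LinearMap.ker_eq_bot, eq_bot_iff]
      intro x hx
      exact hinj x (congrArg Prod.fst hx) (congrArg Prod.snd hx))
    (fun t => by
      obtain ⟨r, rfl⟩ := hεR t
      refine ⟨(r, 0), ?_⟩
      change εR r - εS 0 = _
      rw [map_zero, sub_zero])
    (fun ⟨r, x⟩ => by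
      constructor
      · intro h
        obtain ⟨y, hy, hy'⟩ := hpull r x (sub_eq_zero.mp h)
        exact ⟨y, Prod.ext hy hy'⟩
      · rintro ⟨y, hy⟩
        rw [← hy]
        exact sub_eq_zero.mpr (RingHom.congr_fun hcomm y))
  have h2 := tendsto_hLength_sub_div p hs hd (f := LinearMap.inl P R S) (g := LinearMap.snd P R S)
    LinearMap.inl_injective LinearMap.snd_surjective .inl_snd
  rw [hLength_eq_of_surjective p hπR, hLength_eq_of_surjective p hπS] at h2
  rw [hLength_eq_of_surjective p (R := T) (hεR.comp hπR)] at h1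
  have h3 := h2.sub h1
  rw [sub_zero] at h3
  refine h3.congr fun e => ?_
  ring

end FibreProduct

theorem isNoetherian_of_surjective_algebraMap {P R : Type*} [CommRing P] [CommRing R] [Algebra P R]
    [IsNoetherianRing R] (h : Function.Surjective (algebraMap P R)) : IsNoetherian P R := by
  refine ⟨fun N => ?_⟩
  have := (IsNoetherian.noetherian (Submodule.span R (N : Set R)))
  have h1 := this.restrictScalars_of_surjective h
  rwa [Submodule.restrictScalars_span P R h, Submodule.span_eq] at h1

theorem isNoetherianRing_pullback {R S T : Type*} [CommRing R] [CommRing S] [CommRing T]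
    [IsNoetherianRing R] [IsNoetherianRing S] (εR : R →+* T) (εS : S →+* T)
    (hεR : Function.Surjective εR) (hεS : Function.Surjective εS) :
    IsNoetherianRing (RingHom.pullback εR εS) := by
  let P := RingHom.pullback εR εS
  let := (RingHom.pullbackFst εR εS).toAlgebra
  let := (RingHom.pullbackSnd εR εS).toAlgebra
  have : IsNoetherian P R := isNoetherian_of_surjective_algebraMap
    (RingHom.surjective_pullbackFst_of_surjective εR εS hεS)
  have : IsNoetherian P S := isNoetherian_of_surjective_algebraMap
    (RingHom.surjective_pullbackSnd_of_surjective εR εS hεR)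
  exact isNoetherian_of_injective ((Algebra.linearMap P R).prod (Algebra.linearMap P S))
    fun x y h => Subtype.ext h

section Pullback

variable (p : ℕ) [hp : Fact p.Prime] {R S T : Type*} [CommRing R] [CommRing S] [CommRing T]
  [IsLocalRing R] [IsLocalRing S] [IsLocalRing T] [IsNoetherianRing R] [IsNoetherianRing S]
  [CharP R p] [CharP S p] [CharP T p] {εR : R →+* T} {εS : S →+* T}

theorem hLocal_pullback (hεR : Function.Surjective εR) (hεS : Function.Surjective εS)
    [IsLocalRing (RingHom.pullback εR εS)] {s : ℝ} (hs : 0 < s)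
    (hdim : ringKrullDim S ≤ ringKrullDim R) {lS lT : ℝ}
    (hlS : Tendsto (fun e => hLength p S s S e / (p : ℝ) ^ (e * krullDimNat R)) atTop (𝓝 lS))
    (hlT : Tendsto (fun e => hLength p T s T e / (p : ℝ) ^ (e * krullDimNat R)) atTop (𝓝 lT)) :
    hLocal p (RingHom.pullback εR εS) s = hLocal p R s + lS - lT ∧
      krullDimNat (RingHom.pullback εR εS) = krullDimNat R := by
  have := isNoetherianRing_pullback εR εS hεR hεS
  have : CharP (RingHom.pullback εR εS) p := (CharP.charP_iff_prime_eq_zero hp.out).mpr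
    (Subtype.ext (Prod.ext (CharP.cast_eq_zero R p) (CharP.cast_eq_zero S p)))
  have hπR := RingHom.surjective_pullbackFst_of_surjective εR εS hεS
  have hπS := RingHom.surjective_pullbackSnd_of_surjective εR εS hεR
  have hinj : ∀ x, RingHom.pullbackFst εR εS x = 0 → RingHom.pullbackSnd εR εS x = 0 → x = 0 :=
    fun x h1 h2 => Subtype.ext (Prod.ext h1 h2)
  have hP : ringKrullDim (RingHom.pullback εR εS) = ringKrullDim R :=
    le_antisymm ((ringKrullDim_le_max_of_injective hπR hπS hinj).trans_eq (max_eq_left hdim))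
      (ringKrullDim_le_of_surjective _ hπR)
  have hd : krullDimNat (RingHom.pullback εR εS) = krullDimNat R := by
    rw [krullDimNat, krullDimNat, hP]
  refine ⟨?_, hd⟩
  have h0 := tendsto_hLength_fiberProduct p hs (hP.trans (ringKrullDim_eq_krullDimNat R)).le hεR hπR
    hπS hinj (RingHom.pullback_comm_sq εR εS) fun r x h => ⟨⟨(r, x), h⟩, rfl, rfl⟩
  have h1 := tendsto_hLength_div p (A := RingHom.pullback εR εS) hs
  rw [hd] at h1
  have h2 := (((tendsto_hLength_div p (A := R) hs).add hlS).sub hlT).add h0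
  rw [add_zero] at h2
  refine tendsto_nhds_unique h1 (h2.congr fun e => ?_)
  ring

end Pullback

end HFunction

theorem corollary3p5 (p : ℕ) [Fact p.Prime]
    {R S T : Type*} [CommRing R] [CommRing S] [CommRing T]
    [IsLocalRing R] [IsLocalRing S] [IsLocalRing T]
    [IsNoetherianRing R] [IsNoetherianRing S] [IsNoetherianRing T]
    [CharP R p] [CharP S p] [CharP T p]
    (εR : R →+* T) (εS : S →+* T)
    (hεR : Function.Surjective εR) (hεS : Function.Surjective εS)
    (s : ℝ) (hs : 0 < s) :
    haveI : IsLocalRing (RingHom.pullback εR εS) := isLocalRing_fiberProduct εR εS hεS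
    -- the limits that define the four `h`-functions exist
    (HasHLimit p (RingHom.pullback εR εS) s ∧
      HasHLimit p R s ∧ HasHLimit p S s ∧ HasHLimit p T s) ∧
    (ringKrullDim R = ringKrullDim S ∧ ringKrullDim S = ringKrullDim T →
      hLocal p (RingHom.pullback εR εS) s = hLocal p R s + hLocal p S s - hLocal p T s ∧
      eLocal p (RingHom.pullback εR εS) s = eLocal p R s + eLocal p S s - eLocal p T s) ∧
    (ringKrullDim R = ringKrullDim S ∧ ringKrullDim T < ringKrullDim S →
      hLocal p (RingHom.pullback εR εS) s = hLocal p R s + hLocal p S s ∧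
      eLocal p (RingHom.pullback εR εS) s = eLocal p R s + eLocal p S s) ∧
    (ringKrullDim S < ringKrullDim R ∧ ringKrullDim T < ringKrullDim S →
      hLocal p (RingHom.pullback εR εS) s = hLocal p R s ∧
      eLocal p (RingHom.pullback εR εS) s = eLocal p R s) := by
  have hloc : IsLocalRing (RingHom.pullback εR εS) := isLocalRing_fiberProduct εR εS hεS
  have hnoeth := isNoetherianRing_pullback εR εS hεR hεS
  have hchar : CharP (RingHom.pullback εR εS) p :=
    (CharP.charP_iff_prime_eq_zero Fact.out).mpr
      (Subtype.ext (Prod.ext (CharP.cast_eq_zero R p) (CharP.cast_eq_zero S p)))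
  have hS := tendsto_hLength_div p (A := S) hs
  have hT := tendsto_hLength_div p (A := T) hs
  have hR := ringKrullDim_eq_krullDimNat R
  refine ⟨⟨hasHLimit p hs, hasHLimit p hs, hasHLimit p hs, hasHLimit p hs⟩, ?_, ?_, ?_⟩
  · rintro ⟨hRS, hST⟩
    have hdS : krullDimNat S = krullDimNat R := by rw [krullDimNat, krullDimNat, hRS]
    have hdT : krullDimNat T = krullDimNat R := by rw [krullDimNat, krullDimNat, hRS, hST]
    obtain ⟨h, hd⟩ := hLocal_pullback p hεR hεS hs hRS.ge (hdS ▸ hS) (hdT ▸ hT)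
    refine ⟨h, ?_⟩
    change hLocal _ _ _ / _ = hLocal _ _ _ / _ + hLocal _ _ _ / _ - hLocal _ _ _ / _
    rw [h, hd, hdS, hdT, sub_div, add_div]
  · rintro ⟨hRS, hTS⟩
    have hdS : krullDimNat S = krullDimNat R := by rw [krullDimNat, krullDimNat, hRS]
    obtain ⟨h, hd⟩ := hLocal_pullback p hεR hεS hs hRS.ge (hdS ▸ hS)
      (tendsto_hLength_div_zero p hs (hTS.trans_eq (hRS.symm.trans hR)))
    rw [sub_zero] at h
    refine ⟨h, ?_⟩
    change hLocal _ _ _ / _ = hLocal _ _ _ / _ + hLocal _ _ _ / _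
    rw [h, hd, hdS, add_div]
  · rintro ⟨hSR, hTS⟩
    obtain ⟨h, hd⟩ := hLocal_pullback p hεR hεS hs hSR.le
      (tendsto_hLength_div_zero p hs (hSR.trans_eq hR))
      (tendsto_hLength_div_zero p hs ((hTS.trans hSR).trans_eq hR))
    rw [sub_zero, add_zero] at h
    refine ⟨h, ?_⟩
    change hLocal _ _ _ / _ = hLocal _ _ _ / _
    rw [h, hd]
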